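/- All graphs are finite, undirected and simple. An SNDP instance consists of a graph $G=(V,E)$ with non-negative edge costs, a set $R\subseteq V$ of terminals, and a demand $d_{s,t}\in\mathbb{N}_0$ for every unordered pair of distinct terminals $s,t\in R$; the vertices outside $R$ are called Steiner vertices. Paths are simple. Two distinct paths between $s$ and $t$ are *edge-disjoint* if they share no edge, *element-disjoint* if they share neither an edge nor a Steiner vertex, and *vertex-disjoint* if they share no vertex other than $s$ and $t$. A solution to EC-SNDP (respectively LC-SNDP, VC-SNDP) is a subgraph $H\subseteq G$ with $R\subseteq V(H)$ such that for all distinct $s,t\in R$ the maximum number of pairwise edge-disjoint (respectively element-disjoint, vertex-disjoint) paths between $s$ and $t$ in $H$ is at least $d_{s,t}$. A solution is *minimal* if no edge can be removed from it without making it infeasible. A *leaf* of a tree is a vertex of degree $1$ and an *internal vertex* is one of degree at least $2$; a tree may consist of a single vertex, which is then neither. **Lemma.** 1. Let $H$ be a minimal solution to an LC-SNDP instance. Then there exist pairwise distinct trees $T_1,\dots,T_b\subseteq H$ such that $H=\bigcup_{i=1}^b T_i$, no two of the trees share a Steiner vertex, all leaves of every tree are terminals, and all internal vertices of every tree are Steiner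 vertices. Moreover, for all distinct terminals $s,t\in R$ there exist $d_{s,t}$ pairwise element-disjoint paths between $s$ and $t$ in $H$ such that, for each $i\in\{1,\dots,b\}$, the edge set of $T_i$ intersects the edge set of at most one of these paths. 2. Let $H$ be a minimal solution to an EC-SNDP instance. Then there exist pairwise distinct trees $T_1,\dots,T_b\subseteq H$ such that $H=\bigcup_{i=1}^b T_i$, no two of the trees share an edge, all leaves of every tree are terminals, and all internal vertices of every tree are Steiner vertices. Moreover, for all distinct terminals $s,t\in R$ there exist $d_{s,t}$ pairwise edge-disjoint paths between $s$ and $t$ in $H$ such that, for each $i\in\{1,\dots,b\}$, the edge set of $T_i$ intersects the edge set of at most one of these paths. 3. Let $H$ be a minimal solution to a VC-SNDP instance with $d_{s,t}\le 3$ for all distinct $s,t\in R$. Then there exist trees $T_1,\dots,T_b\subseteq H$ as in the first two sentences of part 1 (pairwise distinct, with union $H$, no two sharing a Steiner vertex, with all leaves terminals and all internal vertices Steiner vertices), such that for all distinct terminals $s,t\in R$ there exist $d_{s,t}$ pairwise vertex-disjoint paths between $s$ and $t$ in $H$ such that, for each $i\in\{1,\dots,b\}$, the edge set of $T_i$ intersects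 the edge set of at most one of these paths. -/

import Mathlib

open scoped NNReal

/-- An instance of the survivable network design problem on the vertex set `V`: an undirected
graph with non-negative edge costs, a set of terminals, and a demand for each unordered pair of
terminals. Only the values of `demand` at pairs of two distinct terminals are ever used. -/
structure SNDPInstance (V : Type*) where
  graph : SimpleGraph V
  cost : graph.edgeSet → ℝ≥0
  terminals : Set V
  demand : Sym2 V → ℕ

namespace SNDP

variable {V : Type*}

/-- The two `s`-`t` paths have no common edge. -/
def EdgeDisjoint {F : SimpleGraph V} {s t : V} (P Q : F.Path s t) : Prop :=
  ∀ e : Sym2 V, e ∈ P.1.edges → e ∉ Q.1.edges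

/-- The two `s`-`t` paths share no element (no edge and no Steiner vertex), i.e. they may only
share terminals. -/
def ElementDisjoint (R : Set V) {F : SimpleGraph V} {s t : V} (P Q : F.Path s t) : Prop :=
  EdgeDisjoint P Q ∧ ∀ v : V, v ∈ P.1.support → v ∈ Q.1.support → v ∈ R

/-- The two `s`-`t` paths are distinct and internally vertex-disjoint. (Distinctness only matters
for the path consisting of the single edge `st`.) -/
def InternallyDisjoint {F : SimpleGraph V} {s t : V} (P Q : F.Path s t) : Prop :=
  P ≠ Q ∧ ∀ v : V, v ∈ P.1.support → v ∈ Q.1.support → v = s ∨ v = t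

/-- The maximum number of edge-disjoint `s`-`t` paths in `F`. -/
noncomputable def edgeConnectivity (F : SimpleGraph V) (s t : V) : ℕ∞ :=
  ⨆ (n : ℕ) (_ : ∃ P : Fin n → F.Path s t, Pairwise fun j k => EdgeDisjoint (P j) (P k)),
    (n : ℕ∞)

/-- The maximum number of element-disjoint `s`-`t` paths in `F`, for the terminal set `R`. -/
noncomputable def elementConnectivity (R : Set V) (F : SimpleGraph V) (s t : V) : ℕ∞ :=
  ⨆ (n : ℕ) (_ : ∃ P : Fin n → F.Path s t, Pairwise fun j k => ElementDisjoint R (P j) (P k)),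
    (n : ℕ∞)

/-- The maximum number of internally vertex-disjoint `s`-`t` paths in `F`. -/
noncomputable def vertexConnectivity (F : SimpleGraph V) (s t : V) : ℕ∞ :=
  ⨆ (n : ℕ) (_ : ∃ P : Fin n → F.Path s t, Pairwise fun j k => InternallyDisjoint (P j) (P k)),
    (n : ℕ∞)

/-- `H` is a subgraph of the input graph that contains all terminals and in which the connectivity,
as measured by `conn`, of any two distinct terminals is at least their demand. The paths of `H`
between vertices of `H` are those of `H.spanningCoe`, which has the same edges. -/
def IsSolution (I : SNDPInstance V) (conn : SimpleGraph V → V → V → ℕ∞)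
    (H : I.graph.Subgraph) : Prop :=
  I.terminals ⊆ H.verts ∧
    ∀ s ∈ I.terminals, ∀ t ∈ I.terminals, s ≠ t →
      (I.demand s(s, t) : ℕ∞) ≤ conn H.spanningCoe s t

/-- A solution from which no edge can be removed without making it infeasible. -/
def IsMinimalSolution (I : SNDPInstance V) (conn : SimpleGraph V → V → V → ℕ∞)
    (H : I.graph.Subgraph) : Prop :=
  IsSolution I conn H ∧ ∀ e ∈ H.edgeSet, ¬ IsSolution I conn (H.deleteEdges {e})

/-- Minimal solutions of the edge-connectivity variant EC-SNDP. -/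
def IsMinimalECSolution (I : SNDPInstance V) (H : I.graph.Subgraph) : Prop :=
  IsMinimalSolution I edgeConnectivity H

/-- Minimal solutions of the element-connectivity variant LC-SNDP. -/
def IsMinimalLCSolution (I : SNDPInstance V) (H : I.graph.Subgraph) : Prop :=
  IsMinimalSolution I (elementConnectivity I.terminals) H

/-- Minimal solutions of the vertex-connectivity variant VC-SNDP. -/
def IsMinimalVCSolution (I : SNDPInstance V) (H : I.graph.Subgraph) : Prop :=
  IsMinimalSolution I vertexConnectivity H

/-- A leaf is a vertex of degree one. -/
def IsLeaf {G : SimpleGraph V} (T : G.Subgraph) (v : V) : Prop :=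
  (T.neighborSet v).ncard = 1

/-- An internal vertex is a vertex of degree at least two. (The vertex of a one-vertex tree is
neither a leaf nor internal.) -/
def IsInternal {G : SimpleGraph V} (T : G.Subgraph) (v : V) : Prop :=
  2 ≤ (T.neighborSet v).ncard

/-- `H` is the union of the trees `T 0, …, T (b - 1)`; the leaves of each of them are in `R` and
the internal vertices are not. -/
def IsTreeDecomposition {G : SimpleGraph V} (R : Set V) (H : G.Subgraph) {b : ℕ}
    (T : Fin b → G.Subgraph) : Prop :=
  H = ⨆ i, T i ∧ ∀ i, (T i).coe.IsTree ∧
    (∀ v, IsLeaf (T i) v → v ∈ R) ∧ (∀ v, IsInternal (T i) v → v ∉ R)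

/-- The edge set of each of the subgraphs `T i` meets at most one of the given paths. -/
def MeetsAtMostOne {G F : SimpleGraph V} {b n : ℕ} {s t : V} (T : Fin b → G.Subgraph)
    (P : Fin n → F.Path s t) : Prop :=
  ∀ i, {j : Fin n | ∃ e ∈ (P j).1.edges, e ∈ (T i).edgeSet}.Subsingleton

end SNDP

/-! The solution $H$ is reduced to a hypergraph on the terminals whose hyperedges are connected
pieces of $H$. In the incidence graph of $H$ (nodes: vertices and edges), element-connectivity says
that every set of non-terminal nodes separating $s$ from $t$ has at least $d_{s,t}$ elements. As in
the reduction of Hind and Oellermann for element-connectivity, an edge $pq$ between two non-terminal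
nodes can always be deleted or contracted without violating a demand
(`SepFeasible.delete_or_merge`): a separation that becomes too small by deletion and one that
becomes too small by contraction would cross, and counting the boundaries of the corners rules this
out (`uncross`).

When this is exhausted (`exists_contraction`), each contracted class is a hyperedge on the terminals
next to it. It is realised in $H$ by a connected subgraph in which terminals have degree at most one
(`piece`), and these subgraphs are edge-disjoint. Menger's theorem in the hypergraph
(`exists_linkage`, `exists_links`) gives $d_{s,t}$ paths that use disjoint sets of pieces.

Such a system of pieces certifies feasibility. So if $H$ is minimal, no system lives in $H-e$, and
this forces the pieces to cover all edges, to be trees and to have no Steiner leaf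
(`IsSystem.exists_treeDecomposition`).

Two parameters cover the three variants. Separators must avoid $U$: it is the set of all terminals
for edge- and element-connectivity, and empty for vertex-connectivity, where demands at most $3$
make the uncrossing work. Each Steiner vertex has one copy per element of `ι`: one copy makes pieces
disjoint at Steiner vertices, while enough copies make Steiner vertices irrelevant, which is
edge-connectivity. -/

namespace SNDP

/-! ### Uncrossing two separations -/

section Uncrossing

variable {K : Type*}

/-- `(A, B)` separates `s` from `t` with respect to the relation `E`: the elements outside
`A ∪ B` form an `s`-`t` separator that contains no element of `U`. -/
structure IsSep (E : K → K → Prop) (U : Set K) (s t : K) (A B : Finset K) : Prop where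
  disj : ∀ x ∈ A, x ∉ B
  left : s ∈ A
  right : t ∈ B
  no_edge : ∀ x ∈ A, ∀ y ∈ B, ¬ E x y
  cover : ∀ x ∈ U, x ∈ A ∨ x ∈ B

/-- The relation `E` without the pair `p`, `q`. -/
def EraseRel (E : K → K → Prop) (p q : K) (x y : K) : Prop :=
  E x y ∧ ¬ (x = p ∧ y = q) ∧ ¬ (x = q ∧ y = p)

theorem IsSep.symm {E : K → K → Prop} (hE : ∀ x y, E x y → E y x) {U : Set K} {s t : K}
    {A B : Finset K} (h : IsSep E U s t A B) : IsSep E U t s B A where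
  disj x hx hx' := h.disj x hx' hx
  left := h.right
  right := h.left
  no_edge x hx y hy hxy := h.no_edge y hy x hx (hE _ _ hxy)
  cover x hx := (h.cover x hx).symm

theorem EraseRel.symm {E : K → K → Prop} (hE : ∀ x y, E x y → E y x) {p q x y : K}
    (h : EraseRel E p q x y) : EraseRel E p q y x :=
  ⟨hE _ _ h.1, fun h' => h.2.2 ⟨h'.2, h'.1⟩, fun h' => h.2.1 ⟨h'.2, h'.1⟩⟩

theorem EraseRel.swap {E : K → K → Prop} {p q : K} : EraseRel E q p = EraseRel E p q := by
  funext x y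
  simp only [EraseRel, eq_iff_iff]
  tauto

variable [Fintype K] [DecidableEq K]

/-- The corner `(A₁ ∩ A₂, B₁ ∪ B₂)` of two crossing separations. -/
theorem corner_card {E : K → K → Prop} {U : Set K} {p q s₁ t₁ s₂ t₂ s t : K} {d : ℕ}
    {A₁ B₁ A₂ B₂ : Finset K}
    (hd : ∀ A B, IsSep E U s t A B → d ≤ (A ∪ B)ᶜ.card)
    (S₁ : IsSep (EraseRel E p q) U s₁ t₁ A₁ B₁) (S₂ : IsSep E U s₂ t₂ A₂ B₂)
    (hp : p ∉ A₂) (hq : q ∉ A₂) (hs₁ : s ∈ A₁) (hs₂ : s ∈ A₂) (ht : t ∈ B₁ ∨ t ∈ B₂) :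
    d ≤ ((A₁ ∪ B₁)ᶜ ∩ A₂).card + ((A₁ ∪ B₁)ᶜ ∩ (A₂ ∪ B₂)ᶜ).card + (A₁ ∩ (A₂ ∪ B₂)ᶜ).card := by
  have hsep : IsSep E U s t (A₁ ∩ A₂) (B₁ ∪ B₂) := by
    refine ⟨?_, by simp [hs₁, hs₂], by simpa using ht, ?_, ?_⟩
    · intro x hx
      have h1 := S₁.disj x
      have h2 := S₂.disj x
      simp only [Finset.mem_inter, Finset.mem_union] at hx ⊢
      tauto
    · intro x hx y hy hxy
      simp only [Finset.mem_inter, Finset.mem_union] at hx hy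
      rcases hy with hy | hy
      -- Both $p$ and $q$ lie outside $A_2$, so the erased pair cannot leave $A_1\cap A_2$: the
      -- corner is a separation for `E` itself.
      · refine S₁.no_edge x hx.1 y hy ⟨hxy, ?_, ?_⟩
        · rintro ⟨rfl, -⟩; exact hp hx.2
        · rintro ⟨rfl, -⟩; exact hq hx.2
      · exact S₂.no_edge x hx.2 y hy hxy
    · intro x hx
      have h1 := S₁.cover x hx
      have h2 := S₂.cover x hx
      simp only [Finset.mem_inter, Finset.mem_union]
      tauto
  refine (hd _ _ hsep).trans ?_
  refine (Finset.card_le_card (t := (A₁ ∪ B₁)ᶜ ∩ A₂ ∪ (A₁ ∪ B₁)ᶜ ∩ (A₂ ∪ B₂)ᶜ ∪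
    A₁ ∩ (A₂ ∪ B₂)ᶜ) ?_).trans ((Finset.card_union_le _ _).trans
      (Nat.add_le_add_right (Finset.card_union_le _ _) _))
  intro x
  simp only [Finset.mem_inter, Finset.mem_union, Finset.mem_compl]
  tauto

theorem card_split {A B C : Finset K} (h : ∀ x ∈ A, x ∉ B) :
    C.card = (C ∩ A).card + (C ∩ B).card + (C ∩ (A ∪ B)ᶜ).card := by
  rw [← Finset.card_union_of_disjoint, ← Finset.card_union_of_disjoint]
  · congr 1
    ext x
    simp only [Finset.mem_inter, Finset.mem_union, Finset.mem_compl]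
    tauto
  · rw [Finset.disjoint_left]
    intro x
    simp only [Finset.mem_inter, Finset.mem_union, Finset.mem_compl]
    tauto
  · rw [Finset.disjoint_left]
    intro x
    have := h x
    simp only [Finset.mem_inter]
    tauto

/-- Write $N_i$ for the complement of $A_i\cup B_i$. Since $A_1\cap N_2=\{p\}$ and $s_1\ne p$, the
vertex $s_1$ is in $A_2$ or $B_2$, say $A_2$. The corner $A_1\cap A_2$ has demand $d_1>|N_1|$ and
gains only $p$ from $A_1\cap N_2$, so $N_1\cap B_2$ is empty. Hence $t_2$ lies in $A_1$ or $B_1$,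
and the boundary of its corner is a part of $N_2$ that misses $q$ or $p$, which is smaller than
$d_2$. -/
theorem uncross_aux {E : K → K → Prop} (hE : ∀ x y, E x y → E y x) {U : Set K}
    {p q s₁ t₁ s₂ t₂ : K} {d₁ d₂ : ℕ} {A₁ B₁ A₂ B₂ : Finset K}
    (h₁ : ∀ A B, IsSep E U s₁ t₁ A B → d₁ ≤ (A ∪ B)ᶜ.card)
    (h₂ : ∀ A B, IsSep E U s₂ t₂ A B → d₂ ≤ (A ∪ B)ᶜ.card)
    (S₁ : IsSep (EraseRel E p q) U s₁ t₁ A₁ B₁) (hp₁ : p ∈ A₁) (hq₁ : q ∈ B₁)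
    (c₁ : (A₁ ∪ B₁)ᶜ.card < d₁)
    (S₂ : IsSep E U s₂ t₂ A₂ B₂) (hp₂ : p ∈ (A₂ ∪ B₂)ᶜ) (hq₂ : q ∈ (A₂ ∪ B₂)ᶜ)
    (c₂ : (A₂ ∪ B₂)ᶜ.card ≤ d₂) (hs : s₁ ≠ p)
    (hone : (A₁ ∩ (A₂ ∪ B₂)ᶜ).card = 1) : False := by
  have k₁ := card_split (C := (A₁ ∪ B₁)ᶜ) S₂.disj
  have k₂ := card_split (C := (A₂ ∪ B₂)ᶜ) S₁.disj
  have hq1 : 1 ≤ (B₁ ∩ (A₂ ∪ B₂)ᶜ).card := 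
    Finset.card_pos.2 ⟨q, Finset.mem_inter.2 ⟨hq₁, hq₂⟩⟩
  rw [Finset.inter_comm _ A₁, Finset.inter_comm _ B₁, Finset.inter_comm _ (A₁ ∪ B₁)ᶜ] at k₂
  have hs₂ : s₁ ∈ A₂ ∨ s₁ ∈ B₂ := by
    by_contra hcon
    obtain ⟨x, hx⟩ := Finset.card_eq_one.1 hone
    have hpx : p ∈ ({x} : Finset K) := hx ▸ Finset.mem_inter.2 ⟨hp₁, hp₂⟩
    have hsx : s₁ ∈ ({x} : Finset K) :=
      hx ▸ Finset.mem_inter.2 ⟨S₁.left, by simpa using hcon⟩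
    rw [Finset.mem_singleton] at hpx hsx
    exact hs (hsx.trans hpx.symm)
  simp only [Finset.mem_compl, Finset.mem_union, not_or] at hp₂ hq₂
  have hsw : IsSep (EraseRel E p q) U t₁ s₁ B₁ A₁ := S₁.symm fun _ _ => EraseRel.symm hE
  have h2sw : IsSep E U t₂ s₂ B₂ A₂ := S₂.symm hE
  have h₂' : ∀ A B, IsSep E U t₂ s₂ A B → d₂ ≤ (A ∪ B)ᶜ.card := fun A B h => by
    rw [Finset.union_comm]; exact h₂ _ _ (h.symm hE)
  rcases hs₂ with hs₂ | hs₂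
  · have e1 := corner_card h₁ S₁ S₂ hp₂.1 hq₂.1 S₁.left hs₂ (Or.inl S₁.right)
    have hb : ((A₁ ∪ B₁)ᶜ ∩ B₂).card = 0 := by omega
    have ht : t₂ ∈ A₁ ∨ t₂ ∈ B₁ := by
      by_contra hcon
      have : t₂ ∈ (A₁ ∪ B₁)ᶜ ∩ B₂ :=
        Finset.mem_inter.2 ⟨by simpa using hcon, S₂.right⟩
      rw [Finset.card_eq_zero.1 hb] at this
      simp at this
    rcases ht with ht | ht
    · have e2 := corner_card h₂' S₁ h2sw hp₂.2 hq₂.2 ht S₂.right (Or.inr S₂.left)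
      rw [Finset.union_comm B₂ A₂] at e2
      omega
    · have e2 := corner_card h₂' hsw h2sw hp₂.2 hq₂.2 ht S₂.right (Or.inr S₂.left)
      rw [Finset.union_comm B₂ A₂, Finset.union_comm B₁ A₁] at e2
      omega
  · have e1 := corner_card h₁ S₁ h2sw hp₂.2 hq₂.2 S₁.left hs₂ (Or.inl S₁.right)
    rw [Finset.union_comm B₂ A₂] at e1
    have hb : ((A₁ ∪ B₁)ᶜ ∩ A₂).card = 0 := by omega
    have ht : s₂ ∈ A₁ ∨ s₂ ∈ B₁ := by
      by_contra hcon
      have : s₂ ∈ (A₁ ∪ B₁)ᶜ ∩ A₂ :=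
        Finset.mem_inter.2 ⟨by simpa using hcon, S₂.left⟩
      rw [Finset.card_eq_zero.1 hb] at this
      simp at this
    rcases ht with ht | ht
    · have e2 := corner_card h₂ S₁ S₂ hp₂.1 hq₂.1 ht S₂.left (Or.inr S₂.right)
      omega
    · have e2 := corner_card h₂ hsw S₂ hp₂.1 hq₂.1 ht S₂.left (Or.inr S₂.right)
      rw [Finset.union_comm B₁ A₁] at e2
      omega

/-- A separation that is violated after the deletion of `pq` and one that is violated after the
contraction of `pq` cannot coexist. -/
theorem uncross {E : K → K → Prop} (hE : ∀ x y, E x y → E y x) {U : Set K}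
    {p q s₁ t₁ s₂ t₂ : K} {d₁ d₂ : ℕ} {A₁ B₁ A₂ B₂ : Finset K}
    (h₁ : ∀ A B, IsSep E U s₁ t₁ A B → d₁ ≤ (A ∪ B)ᶜ.card)
    (h₂ : ∀ A B, IsSep E U s₂ t₂ A B → d₂ ≤ (A ∪ B)ᶜ.card)
    (S₁ : IsSep (EraseRel E p q) U s₁ t₁ A₁ B₁) (hp₁ : p ∈ A₁) (hq₁ : q ∈ B₁)
    (c₁ : (A₁ ∪ B₁)ᶜ.card < d₁)
    (S₂ : IsSep E U s₂ t₂ A₂ B₂) (hp₂ : p ∈ (A₂ ∪ B₂)ᶜ) (hq₂ : q ∈ (A₂ ∪ B₂)ᶜ)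
    (c₂ : (A₂ ∪ B₂)ᶜ.card ≤ d₂) (hs : s₁ ≠ p) (ht : t₁ ≠ q)
    (hU : (s₁ ∈ U ∧ t₁ ∈ U ∧ s₂ ∈ U ∧ t₂ ∈ U) ∨ d₂ ≤ 3) : False := by
  have hsw : IsSep (EraseRel E p q) U t₁ s₁ B₁ A₁ := S₁.symm fun _ _ => EraseRel.symm hE
  have h2sw : IsSep E U t₂ s₂ B₂ A₂ := S₂.symm hE
  have h₁' : ∀ A B, IsSep E U t₁ s₁ A B → d₁ ≤ (A ∪ B)ᶜ.card := fun A B h => by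
    rw [Finset.union_comm]; exact h₁ _ _ (h.symm hE)
  have h₂' : ∀ A B, IsSep E U t₂ s₂ A B → d₂ ≤ (A ∪ B)ᶜ.card := fun A B h => by
    rw [Finset.union_comm]; exact h₂ _ _ (h.symm hE)
  have k₁ := card_split (C := (A₁ ∪ B₁)ᶜ) S₂.disj
  have k₂ := card_split (C := (A₂ ∪ B₂)ᶜ) S₁.disj
  rw [Finset.inter_comm _ A₁, Finset.inter_comm _ B₁, Finset.inter_comm _ (A₁ ∪ B₁)ᶜ] at k₂
  have hp1 : 1 ≤ (A₁ ∩ (A₂ ∪ B₂)ᶜ).card :=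
    Finset.card_pos.2 ⟨p, Finset.mem_inter.2 ⟨hp₁, hp₂⟩⟩
  have hq1 : 1 ≤ (B₁ ∩ (A₂ ∪ B₂)ᶜ).card :=
    Finset.card_pos.2 ⟨q, Finset.mem_inter.2 ⟨hq₁, hq₂⟩⟩
  rcases hU with ⟨hs₁, ht₁, hs₂, ht₂⟩ | hd
  · have hp := hp₂
    have hq := hq₂
    simp only [Finset.mem_compl, Finset.mem_union, not_or] at hp hq
    have c11 := fun h => corner_card h₁ S₁ S₂ hp.1 hq.1 S₁.left h (Or.inl S₁.right)
    have c12 := fun h => corner_card h₁ S₁ h2sw hp.2 hq.2 S₁.left h (Or.inl S₁.right)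
    have c13 := fun h => corner_card h₁' hsw S₂ hp.1 hq.1 S₁.right h (Or.inl S₁.left)
    have c14 := fun h => corner_card h₁' hsw h2sw hp.2 hq.2 S₁.right h (Or.inl S₁.left)
    have c21 := fun h => corner_card h₂ S₁ S₂ hp.1 hq.1 h S₂.left (Or.inr S₂.right)
    have c22 := fun h => corner_card h₂ hsw S₂ hp.1 hq.1 h S₂.left (Or.inr S₂.right)
    have c23 := fun h => corner_card h₂' S₁ h2sw hp.2 hq.2 h S₂.right (Or.inr S₂.left)
    have c24 := fun h => corner_card h₂' hsw h2sw hp.2 hq.2 h S₂.right (Or.inr S₂.left)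
    rw [Finset.union_comm B₂ A₂] at c12 c14 c23 c24
    rw [Finset.union_comm B₁ A₁] at c13 c14 c22 c24
    -- The boundaries of two opposite corners have total size $|N_1|+|N_2|<d_1+d_2$. For every
    -- position of the four ends, either some opposite pair has one corner of demand $d_1$ and one
    -- of demand $d_2$, or one pair has demand $d_1$ twice and the other $d_2$ twice.
    rcases S₂.cover _ hs₁ with x1 | x1 <;> rcases S₂.cover _ ht₁ with x2 | x2 <;>
    rcases S₁.cover _ hs₂ with x3 | x3 <;> rcases S₁.cover _ ht₂ with x4 | x4 <;>
    simp only [x1, x2, x3, x4, forall_const] at c11 c12 c13 c14 c21 c22 c23 c24 <;> omega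
  -- The second separator has at most three elements, with $p$ on one side of the first separation
  -- and $q$ on the other, so one of them is alone on its side.
  · have : (A₁ ∩ (A₂ ∪ B₂)ᶜ).card = 1 ∨ (B₁ ∩ (A₂ ∪ B₂)ᶜ).card = 1 := by omega
    rcases this with h | h
    · exact uncross_aux hE h₁ h₂ S₁ hp₁ hq₁ c₁ S₂ hp₂ hq₂ c₂ hs h
    · rw [← EraseRel.swap] at hsw
      exact uncross_aux hE h₁' h₂ hsw hq₁ hp₁ (by rwa [Finset.union_comm]) S₂ hq₂ hp₂ c₂ ht h

end Uncrossing

end SNDP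

namespace SNDP

/-! ### Deleting and contracting edges between non-terminal nodes -/

section Contraction

variable {X : Type*}

/-- Adjacency of colour classes. -/
def ColourRel (Γ : SimpleGraph X) (c : X → X) (k l : X) : Prop :=
  ∃ x y, Γ.Adj x y ∧ c x = k ∧ c y = l

theorem ColourRel.symm {Γ : SimpleGraph X} {c : X → X} (k l : X) (h : ColourRel Γ c k l) :
    ColourRel Γ c l k := by
  obtain ⟨x, y, h, hx, hy⟩ := h
  exact ⟨y, x, h.symm, hy, hx⟩

/-- The edges of `Γ` between equally coloured vertices outside `Q`. -/
def monoGraph (Γ : SimpleGraph X) (Q : Set X) (c : X → X) : SimpleGraph X where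
  Adj x y := Γ.Adj x y ∧ x ∉ Q ∧ y ∉ Q ∧ c x = c y
  symm := ⟨fun _ _ h => ⟨h.1.symm, h.2.2.1, h.2.1, h.2.2.2.symm⟩⟩
  loopless := ⟨fun _ h => h.1.ne rfl⟩

/-- The colouring `c` fixes `Q`, and its classes are singletons in `Q` or connected outside `Q`. -/
structure IsContraction (Γ : SimpleGraph X) (Q : Set X) (c : X → X) : Prop where
  fix : ∀ r ∈ Q, c r = r
  mem : ∀ x, c x ∈ Q → x ∈ Q
  reach : ∀ x y, c x = c y → (monoGraph Γ Q c).Reachable x y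

/-- After contraction of the colour classes, all separators respect the demands `d`. -/
def SepFeasible [Fintype X] [DecidableEq X] (Γ : SimpleGraph X) (Q U : Set X) (d : X → X → ℕ) (c : X → X) : Prop :=
  ∀ s ∈ Q, ∀ t ∈ Q, s ≠ t → ∀ A B, IsSep (ColourRel Γ c) U s t A B → d s t ≤ (A ∪ B)ᶜ.card

/-- The colouring obtained by recolouring the class `q` with `p`. -/
def mergeColour [DecidableEq X] (p q : X) (c : X → X) (x : X) : X := if c x = q then p else c x

/-- Classes are connected by monochromatic edges, so losing a dichromatic one does no harm. -/
theorem IsContraction.delete {Γ : SimpleGraph X} {Q : Set X} {c : X → X}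
    (h : IsContraction Γ Q c) {p q : X} (hpq : c p ≠ c q) :
    IsContraction (Γ.deleteEdges {s(p, q)}) Q c where
  fix := h.fix
  mem := h.mem
  reach x y hxy := by
    refine (h.reach x y hxy).mono ?_
    intro a b hab
    refine ⟨?_, hab.2⟩
    rw [SimpleGraph.deleteEdges_adj]
    refine ⟨hab.1, ?_⟩
    simp only [Set.mem_singleton_iff, Sym2.eq_iff]
    have := hab.2.2.2
    rintro (⟨rfl, rfl⟩ | ⟨rfl, rfl⟩)
    · exact hpq this
    · exact hpq this.symm

theorem IsContraction.merge [DecidableEq X] {Γ : SimpleGraph X} {Q : Set X} {c : X → X}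
    (h : IsContraction Γ Q c) {p q : X} (hadj : Γ.Adj p q) (hp : p ∉ Q) (hq : q ∉ Q) :
    IsContraction Γ Q (mergeColour (c p) (c q) c) where
  fix r hr := by
    have : c r ≠ c q := fun h' => hq (h.mem q (h' ▸ (h.fix r hr).symm ▸ hr))
    rw [mergeColour, if_neg this, h.fix r hr]
  mem x hx := by
    unfold mergeColour at hx
    split_ifs at hx with h'
    · exact absurd (h.mem p hx) hp
    · exact h.mem x hx
  reach x y hxy := by
    have hmono : monoGraph Γ Q c ≤ monoGraph Γ Q (mergeColour (c p) (c q) c) := by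
      intro a b hab
      refine ⟨hab.1, hab.2.1, hab.2.2.1, ?_⟩
      simp only [mergeColour, hab.2.2.2]
    have hr : ∀ x y, c x = c y → (monoGraph Γ Q (mergeColour (c p) (c q) c)).Reachable x y :=
      fun x y h' => (h.reach x y h').mono hmono
    have hpq : (monoGraph Γ Q (mergeColour (c p) (c q) c)).Reachable p q := by
      refine SimpleGraph.Adj.reachable ⟨hadj, hp, hq, ?_⟩
      simp [mergeColour]
    unfold mergeColour at hxy
    split_ifs at hxy with h1 h2 h2
    · exact hr _ _ (h1.trans h2.symm)
    · exact (hr _ _ h1).trans (hpq.symm.trans (hr _ _ hxy))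
    · exact (hr _ _ hxy).trans (hpq.trans (hr _ _ h2.symm))
    · exact hr _ _ hxy

variable [Fintype X] [DecidableEq X]

/-- Deleting or contracting an edge between two vertices outside `Q` preserves feasibility. -/
theorem SepFeasible.delete_or_merge {Γ : SimpleGraph X} {Q U : Set X} {d : X → X → ℕ} {c : X → X}
    (hc : IsContraction Γ Q c) (hUQ : U ⊆ Q)
    (hd : U = Q ∨ ∀ s ∈ Q, ∀ t ∈ Q, s ≠ t → d s t ≤ 3)
    (hf : SepFeasible Γ Q U d c) {p q : X} (hp : p ∉ Q) (hq : q ∉ Q)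
    (hpq : c p ≠ c q) :
    SepFeasible (Γ.deleteEdges {s(p, q)}) Q U d c ∨
      SepFeasible Γ Q U d (mergeColour (c p) (c q) c) := by
  have hpQ : c p ∉ Q := fun h => hp (hc.mem p h)
  have hqQ : c q ∉ Q := fun h => hq (hc.mem q h)
  by_contra hcon
  simp only [SepFeasible, not_or, not_forall, not_le] at hcon
  obtain ⟨⟨s₁, hs₁, t₁, ht₁, hne₁, A₁, B₁, S₁, c₁⟩, ⟨s₂, hs₂, t₂, ht₂, hne₂, A, B, S, hlt⟩⟩ := hcon
  have hE : ∀ x y, ColourRel Γ c x y → ColourRel Γ c y x := ColourRel.symm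
  -- the first separation, in the colour graph without the pair `c p`, `c q`
  have S₁' : IsSep (EraseRel (ColourRel Γ c) (c p) (c q)) U s₁ t₁ A₁ B₁ := by
    refine ⟨S₁.disj, S₁.left, S₁.right, ?_, S₁.cover⟩
    rintro x hx y hy ⟨⟨a, b, hab, rfl, rfl⟩, h1, h2⟩
    refine S₁.no_edge _ hx _ hy ⟨a, b, ?_, rfl, rfl⟩
    rw [SimpleGraph.deleteEdges_adj]
    refine ⟨hab, ?_⟩
    simp only [Set.mem_singleton_iff, Sym2.eq_iff]
    rintro (⟨rfl, rfl⟩ | ⟨rfl, rfl⟩)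
    · exact h1 ⟨rfl, rfl⟩
    · exact h2 ⟨rfl, rfl⟩
  -- Otherwise the pair does not cross the separation, which would then already violate feasibility
  -- before the deletion.
  have hside : (c p ∈ A₁ ∧ c q ∈ B₁) ∨ (c q ∈ A₁ ∧ c p ∈ B₁) := by
    by_contra hcon
    refine absurd (hf s₁ hs₁ t₁ ht₁ hne₁ A₁ B₁ ⟨S₁.disj, S₁.left, S₁.right, ?_, S₁.cover⟩)
      (not_le.2 c₁)
    intro x hx y hy hxy
    refine S₁'.no_edge x hx y hy ⟨hxy, ?_, ?_⟩
    · rintro ⟨rfl, rfl⟩; exact hcon (Or.inl ⟨hx, hy⟩)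
    · rintro ⟨rfl, rfl⟩; exact hcon (Or.inr ⟨hx, hy⟩)
  -- the second separation, pulled back along the contraction
  set μ : X → X := fun k => if k = c q then c p else k with hμ
  have hμQ : ∀ r ∈ Q, μ r = r := fun r hr =>
    if_neg fun (h : r = c q) => hqQ (h ▸ hr)
  set A₂ := Finset.univ.filter fun k => μ k ∈ A with hA₂
  set B₂ := Finset.univ.filter fun k => μ k ∈ B with hB₂
  have mA : ∀ k, k ∈ A₂ ↔ μ k ∈ A := fun k => by simp [hA₂]
  have mB : ∀ k, k ∈ B₂ ↔ μ k ∈ B := fun k => by simp [hB₂]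
  have S₂ : IsSep (ColourRel Γ c) U s₂ t₂ A₂ B₂ := by
    refine ⟨fun x hx hx' => S.disj _ ((mA x).1 hx) ((mB x).1 hx'),
      (mA _).2 ((hμQ s₂ hs₂).symm ▸ S.left), (mB _).2 ((hμQ t₂ ht₂).symm ▸ S.right), ?_, ?_⟩
    · rintro x hx y hy ⟨a, b, hab, rfl, rfl⟩
      exact S.no_edge _ ((mA _).1 hx) _ ((mB _).1 hy) ⟨a, b, hab, rfl, rfl⟩
    · intro x hx
      rw [mA, mB, hμQ x (hUQ hx)]
      exact S.cover x hx
  have hle := hf s₂ hs₂ t₂ ht₂ hne₂ A₂ B₂ S₂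
  have hμN : ∀ k, k ∈ (A₂ ∪ B₂)ᶜ ↔ μ k ∈ (A ∪ B)ᶜ := fun k => by
    simp only [Finset.mem_compl, Finset.mem_union, mA, mB]
  -- If the merged class were not in the separator, the pulled-back separator would be no larger,
  -- against feasibility before the merge.
  have hpN : c p ∈ (A ∪ B)ᶜ := by
    by_contra hpN
    refine absurd (hle.trans (Finset.card_le_card ?_)) (not_le.2 hlt)
    intro k hk
    rw [hμN] at hk
    by_cases hkq : k = c q
    · rw [hμ] at hk
      simp only [hkq, if_true] at hk
      exact absurd hk hpN
    · rwa [hμ, show (fun k => if k = c q then c p else k) k = k from if_neg hkq] at hk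
  have hp₂ : c p ∈ (A₂ ∪ B₂)ᶜ := by
    rw [hμN, hμ]
    simpa [hpq] using hpN
  have hq₂ : c q ∈ (A₂ ∪ B₂)ᶜ := by
    rw [hμN, hμ]
    simpa using hpN
  -- Pulling back adds only `c q` to a separator of size less than the demand.
  have c₂ : (A₂ ∪ B₂)ᶜ.card ≤ d s₂ t₂ := by
    have h1 : ((A₂ ∪ B₂)ᶜ.erase (c q)) ⊆ (A ∪ B)ᶜ := by
      intro k hk
      rw [Finset.mem_erase, hμN] at hk
      rw [hμ, show (fun k => if k = c q then c p else k) k = k from if_neg hk.1] at hk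
      exact hk.2
    have h2 := Finset.card_le_card h1
    rw [Finset.card_erase_of_mem hq₂] at h2
    omega
  have hU : (s₁ ∈ U ∧ t₁ ∈ U ∧ s₂ ∈ U ∧ t₂ ∈ U) ∨ d s₂ t₂ ≤ 3 := by
    rcases hd with rfl | hd
    · exact Or.inl ⟨hs₁, ht₁, hs₂, ht₂⟩
    · exact Or.inr (hd _ hs₂ _ ht₂ hne₂)
  have hne : ∀ r ∈ Q, ∀ k, k ∉ Q → r ≠ k := fun r hr k hk h => hk (h ▸ hr)
  rcases hside with ⟨h1, h2⟩ | ⟨h1, h2⟩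
  · exact uncross hE (hf s₁ hs₁ t₁ ht₁ hne₁) (hf s₂ hs₂ t₂ ht₂ hne₂) S₁' h1 h2 c₁ S₂ hp₂ hq₂ c₂
      (hne _ hs₁ _ hpQ) (hne _ ht₁ _ hqQ) hU
  · rw [← EraseRel.swap] at S₁'
    exact uncross hE (hf s₁ hs₁ t₁ ht₁ hne₁) (hf s₂ hs₂ t₂ ht₂ hne₂) S₁' h1 h2 c₁ S₂ hq₂ hp₂ c₂
      (hne _ hs₁ _ hqQ) (hne _ ht₁ _ hpQ) hU

/-- Some subgraph stays feasible when all its components outside `Q` are contracted. -/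
theorem exists_contraction {Q U : Set X} {d : X → X → ℕ} (hUQ : U ⊆ Q)
    (hd : U = Q ∨ ∀ s ∈ Q, ∀ t ∈ Q, s ≠ t → d s t ≤ 3) (n : ℕ) :
    ∀ (Γ : SimpleGraph X) (c : X → X), IsContraction Γ Q c → SepFeasible Γ Q U d c →
      {z : X × X | Γ.Adj z.1 z.2 ∧ z.1 ∉ Q ∧ z.2 ∉ Q ∧ c z.1 ≠ c z.2}.ncard = n →
    ∃ Γ' ≤ Γ, ∃ c', IsContraction Γ' Q c' ∧ SepFeasible Γ' Q U d c' ∧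
      ∀ x y, Γ'.Adj x y → x ∉ Q → y ∉ Q → c' x = c' y := by
  induction n using Nat.strong_induction_on with
  | _ n ih =>
    intro Γ c hc hf hn
    by_cases hall : ∀ x y, Γ.Adj x y → x ∉ Q → y ∉ Q → c x = c y
    · exact ⟨Γ, le_rfl, c, hc, hf, hall⟩
    push Not at hall
    obtain ⟨p, q, hadj, hp, hq, hpq⟩ := hall
    -- Deletion removes the pair $(p,q)$ from the counted set and merging makes it monochromatic, so
    -- `n` drops in both cases.
    rcases hf.delete_or_merge hc hUQ hd hp hq hpq with h | h
    · have hle : Γ.deleteEdges {s(p, q)} ≤ Γ := SimpleGraph.deleteEdges_le _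
      have hlt : {z : X × X | (Γ.deleteEdges {s(p, q)}).Adj z.1 z.2 ∧ z.1 ∉ Q ∧ z.2 ∉ Q ∧
          c z.1 ≠ c z.2}.ncard < n := by
        rw [← hn]
        refine Set.ncard_lt_ncard ⟨fun z hz => ⟨hle hz.1, hz.2⟩, fun hsub => ?_⟩ (Set.toFinite _)
        have := (hsub (show (p, q) ∈ _ from ⟨hadj, hp, hq, hpq⟩)).1
        simp [SimpleGraph.deleteEdges_adj] at this
      obtain ⟨Γ', hΓ', c', h'⟩ := ih _ hlt _ c (hc.delete hpq) h rfl
      exact ⟨Γ', hΓ'.trans hle, c', h'⟩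
    · have hlt : {z : X × X | Γ.Adj z.1 z.2 ∧ z.1 ∉ Q ∧ z.2 ∉ Q ∧
          mergeColour (c p) (c q) c z.1 ≠ mergeColour (c p) (c q) c z.2}.ncard < n := by
        rw [← hn]
        refine Set.ncard_lt_ncard ⟨fun z hz => ⟨hz.1, hz.2.1, hz.2.2.1, fun he => hz.2.2.2 ?_⟩,
          fun hsub => ?_⟩ (Set.toFinite _)
        · simp only [mergeColour, he]
        · have := (hsub (show (p, q) ∈ _ from ⟨hadj, hp, hq, hpq⟩)).2.2.2
          simp [mergeColour] at this
      exact ih _ hlt _ _ (hc.merge hadj hp hq) h rfl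

end Contraction

end SNDP

namespace SNDP

/-! ### Menger's theorem from Hall's theorem -/

section Menger

open Relation

variable {Y : Type*}

/-- Menger's theorem: if every separator of `A` from `B` has at least `|A|` elements, then `A` is
linked to `B` by paths with pairwise disjoint vertex sets `O a`, `a ∈ A`. -/
theorem exists_linkage [Finite Y] (E : Y → Y → Prop) (A B : Set Y)
    (h : ∀ Z : Set Y, (∀ a ∈ A, a ∉ Z → ∀ b ∈ B, ¬ ReflTransGen (fun x y => E x y ∧ y ∉ Z) a b) →
      A.ncard ≤ Z.ncard) :
    ∃ O : Y → Set Y, (∀ a ∈ A, ∀ a' ∈ A, ∀ y, y ∈ O a → y ∈ O a' → a = a') ∧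
      ∀ a ∈ A, ∃ b ∈ B, ReflTransGen (fun x y => E x y ∧ x ∈ O a ∧ y ∈ O a) a b := by
  classical
  have := Fintype.ofFinite Y
  -- A matching of the elements outside $B$ into those outside $A$ encodes the linkage: `f y = y`
  -- means that `y` is unused, and otherwise `f y` is the successor of `y` on its path.
  let N : {y // y ∉ B} → Finset Y := fun y =>
    Finset.univ.filter fun w => w ∉ A ∧ (w = y ∨ E y w)
  obtain ⟨f, hf, hfN⟩ := (Finset.all_card_le_biUnion_card_iff_exists_injective N).1 (by
    intro s
    set S : Finset Y := s.map (Function.Embedding.subtype _) with hS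
    have hSB : ∀ x ∈ S, x ∉ B := by
      intro x hx
      simp only [hS, Finset.mem_map, Function.Embedding.subtype_apply] at hx
      obtain ⟨y, -, rfl⟩ := hx
      exact y.2
    set A' : Finset Y := Finset.univ.filter (· ∈ A) with hA'
    have hA : A.ncard = A'.card := by
      rw [← Set.ncard_coe_finset]; congr 1; ext x; simp [hA']
    set W : Finset Y := Finset.univ.filter fun w => w ∉ A ∧ w ∉ S ∧ ∃ x ∈ S, E x w with hW
    -- Whatever is reachable from $A$ while avoiding $(A\setminus S)\cup W$ stays in $S$, which
    -- misses $B$. The resulting bound $|A\cap S|\le|W|$ is Hall's condition for $S$.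
    have h1 : A.ncard ≤ ((A' \ S ∪ W : Finset Y) : Set Y).ncard := by
      refine h _ fun a ha haZ b hb hab => ?_
      have key : ∀ y, ReflTransGen (fun x y => E x y ∧ y ∉ ((A' \ S ∪ W : Finset Y) : Set Y)) a y →
          y ∈ S := by
        intro y hy
        induction hy with
        | refl =>
          by_contra hcon
          exact haZ (by simp [hA', ha, hcon])
        | @tail x y _ hxy ih =>
          by_contra hcon
          refine hxy.2 ?_
          by_cases hyA : y ∈ A
          · simp [hA', hyA, hcon]
          · have : y ∈ W := by
              simp only [hW, Finset.mem_filter, Finset.mem_univ, true_and]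
              exact ⟨hyA, hcon, x, ih, hxy.1⟩
            simp [this]
      exact hSB b (key b hab) hb
    rw [Set.ncard_coe_finset, hA] at h1
    have h2 := Finset.card_union_le (A' \ S) W
    have h3 := Finset.card_sdiff_add_card_inter A' S
    have h4 := Finset.card_sdiff_add_card_inter S A'
    rw [Finset.inter_comm] at h4
    have h5 : (S \ A').card + W.card ≤ (s.biUnion N).card := by
      rw [← Finset.card_union_of_disjoint]
      · refine Finset.card_le_card ?_
        intro w hw
        simp only [Finset.mem_union, Finset.mem_sdiff, hA', hW, Finset.mem_filter,
          Finset.mem_univ, true_and, hS, Finset.mem_map, Function.Embedding.subtype_apply] at hw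
        simp only [Finset.mem_biUnion, N, Finset.mem_filter, Finset.mem_univ, true_and]
        rcases hw with ⟨⟨y, hy, rfl⟩, hw⟩ | ⟨hw, -, ⟨x, ⟨y, hy, rfl⟩, hx⟩⟩
        · exact ⟨y, hy, hw, Or.inl rfl⟩
        · exact ⟨y, hy, hw, Or.inr hx⟩
      · rw [Finset.disjoint_left]
        intro x hx hx'
        simp only [hW, Finset.mem_filter, Finset.mem_univ, true_and] at hx'
        exact hx'.2.1 (Finset.mem_sdiff.1 hx).1
    have h6 : S.card = s.card := by rw [hS, Finset.card_map]
    omega)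
  have hfA : ∀ y, f y ∉ A := fun y => (Finset.mem_filter.1 (hfN y)).2.1
  have hfE : ∀ y, f y = y ∨ E y (f y) := fun y => (Finset.mem_filter.1 (hfN y)).2.2
  let step : Y → Y → Prop := fun x y => ∃ hx : x ∉ B, f ⟨x, hx⟩ = y
  refine ⟨fun a => {y | ReflTransGen step a y}, ?_, ?_⟩
  · intro a ha a' ha' y hy hy'
    change ReflTransGen step a y at hy
    change ReflTransGen step a' y at hy'
    induction hy with
    | refl =>
      rcases hy'.cases_tail with h | ⟨x, -, hx, h⟩
      · exact h
      · exact absurd ha (h ▸ hfA _)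
    | @tail x y hax hxy ih =>
      obtain ⟨hx, hxy⟩ := hxy
      rcases hy'.cases_tail with h | ⟨x', hx'a, hx', h⟩
      · exact absurd ha' (h ▸ hxy ▸ hfA _)
      · have : x' = x := by simpa using hf (h.trans hxy.symm)
        exact ih (this ▸ hx'a)
  · intro a ha
    -- If the orbit of `a` never met $B$, then `f` would be an injective, hence surjective, self-map
    -- of this finite set, although `a` is not a value of `f`.
    have hb : ∃ b ∈ B, ReflTransGen step a b := by
      by_contra! hcon
      have hnB : ∀ y, ReflTransGen step a y → y ∉ B := fun y hy hyB => hcon y hyB hy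
      let g : {y // ReflTransGen step a y} → {y // ReflTransGen step a y} :=
        fun y => ⟨f ⟨y, hnB y y.2⟩, y.2.tail ⟨hnB y y.2, rfl⟩⟩
      have hg : Function.Injective g := by
        intro x y hxy
        have := hf (Subtype.ext_iff.1 hxy)
        exact Subtype.ext (Subtype.mk.inj this)
      obtain ⟨y, hy⟩ := Finite.surjective_of_injective hg ⟨a, .refl⟩
      have hy' : f ⟨y, hnB y y.2⟩ = a := Subtype.ext_iff.1 hy
      exact hfA _ (hy' ▸ ha)
    obtain ⟨b, hbB, hab⟩ := hb
    refine ⟨b, hbB, ?_⟩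
    clear hbB
    induction hab with
    | refl => exact .refl
    | @tail x y hax hxy ih =>
      have hay := hax.tail hxy
      obtain ⟨hx, hxy⟩ := hxy
      rcases hfE ⟨x, hx⟩ with h | h
      · have : y = x := hxy.symm.trans h
        exact this ▸ ih
      · exact ih.tail ⟨hxy ▸ h, hax, hay⟩

end Menger

end SNDP

namespace SNDP

/-! ### Hypergraphs of connected subgraphs and disjoint links in them -/

section Hypergraph

open Relation

variable {V K : Type*} {G : SimpleGraph V}

/-- A connected subgraph in which the vertices of `R` have degree at most one. -/
structure IsGood (R : Set V) (T : G.Subgraph) : Prop where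
  conn : ∀ u ∈ T.verts, ∀ w ∈ T.verts, T.spanningCoe.Reachable u w
  deg : ∀ r ∈ R, ∀ x y, T.Adj r x → T.Adj r y → x = y

/-- The edges of the `T k`, `k ∈ κ`, whose ends are in `M` if they are in `R`. -/
def linkGraph (R : Set V) (T : K → G.Subgraph) (κ : Set K) (M : Set V) : SimpleGraph V where
  Adj a b := (∃ k ∈ κ, (T k).Adj a b) ∧ (a ∈ R → a ∈ M) ∧ (b ∈ R → b ∈ M)
  symm := ⟨fun _ _ ⟨⟨k, hk, h⟩, ha, hb⟩ => ⟨⟨k, hk, h.symm⟩, hb, ha⟩⟩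
  loopless := ⟨fun _ ⟨⟨_, _, h⟩, _⟩ => h.ne rfl⟩

theorem linkGraph_mono {R : Set V} {T : K → G.Subgraph} {κ κ' : Set K} {M M' : Set V}
    (hκ : κ ⊆ κ') (hM : M ⊆ M') : linkGraph R T κ M ≤ linkGraph R T κ' M' :=
  fun _ _ ⟨⟨k, hk, h⟩, ha, hb⟩ => ⟨⟨k, hκ hk, h⟩, fun h => hM (ha h), fun h => hM (hb h)⟩

/-- A vertex of degree at most one cannot be interior to a path, so the link meets $R$ at most in
its ends. The induction steps over a vertex of $R$ by returning to its only neighbour. -/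
theorem IsGood.reachable {R : Set V} {T : K → G.Subgraph} {k : K} (h : IsGood R (T k)) {u w : V}
    (hu : u ∈ (T k).verts) (hw : w ∈ (T k).verts) :
    (linkGraph R T {k} {u, w}).Reachable u w := by
  have key : ∀ x, (T k).spanningCoe.Reachable x w →
      (x ∉ R → (linkGraph R T {k} {w}).Reachable x w) ∧
      (x ∈ R → x = w ∨ ∃ y, (T k).Adj x y ∧ (y ∈ R → y = w) ∧
        (linkGraph R T {k} {w}).Reachable y w) := by
    intro x hx
    rw [SimpleGraph.reachable_iff_reflTransGen] at hx
    induction hx using ReflTransGen.head_induction_on with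
    | refl => exact ⟨fun _ => .rfl, fun _ => Or.inl rfl⟩
    | @head x x' hadj _ ih =>
      rw [SimpleGraph.Subgraph.spanningCoe_adj] at hadj
      by_cases hx' : x' ∈ R
      · rcases ih.2 hx' with rfl | ⟨y, hy, hyR, hyw⟩
        · refine ⟨fun hx => ?_, fun hx => Or.inr ⟨x', hadj, fun _ => rfl, .rfl⟩⟩
          exact SimpleGraph.Adj.reachable ⟨⟨k, rfl, hadj⟩, fun h => absurd h hx, fun _ => rfl⟩
        · obtain rfl : x = y := h.deg x' hx' _ _ hadj.symm hy
          exact ⟨fun _ => hyw, fun hx => Or.inl (hyR hx)⟩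
      · have hr := ih.1 hx'
        refine ⟨fun hx => ?_, fun hx => Or.inr ⟨x', hadj, fun h => absurd h hx', hr⟩⟩
        refine SimpleGraph.Reachable.trans (SimpleGraph.Adj.reachable ?_) hr
        exact ⟨⟨k, rfl, hadj⟩, fun h => absurd h hx, fun h => absurd h hx'⟩
  have hmono : linkGraph R T {k} {w} ≤ linkGraph R T {k} {u, w} :=
    linkGraph_mono subset_rfl (by simp)
  obtain ⟨h1, h2⟩ := key u (h.conn u hu w hw)
  by_cases huR : u ∈ R
  · rcases h2 huR with rfl | ⟨y, hy, hyR, hyw⟩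
    · exact .rfl
    · refine SimpleGraph.Reachable.trans (SimpleGraph.Adj.reachable ?_) (hyw.mono hmono)
      exact ⟨⟨k, rfl, hy⟩, fun _ => by simp, fun h => by simp [hyR h]⟩
  · exact (h1 huR).mono hmono

/-- One can go from `u` to `v` in one of the `T k`, `k ∉ N`, where `v` is in `R` but not in `M`. -/
def HyperStep (R : Set V) (T : K → G.Subgraph) (N : Set K) (M : Set V) (u v : V) : Prop :=
  ∃ k, k ∉ N ∧ u ∈ (T k).verts ∧ v ∈ (T k).verts ∧ v ∈ R ∧ v ∉ M

/-- In the hypergraph on `R` that is given by the vertex sets of the `T k`, every `s`-`t` separator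
that consists of hyperedges and vertices outside `U` has at least `d` elements. -/
def HyperFeasible (R U : Set V) (T : K → G.Subgraph) (s t : V) (d : ℕ) : Prop :=
  ∀ (N : Set K) (M : Set V), s ∉ M → t ∉ M → (∀ v ∈ M, v ∈ R ∧ v ∉ U) →
    ¬ ReflTransGen (HyperStep R T N M) s t → d ≤ N.ncard + M.ncard

/-- Hypergraph walks from $s\in R$ visit only vertices of $R$, so members may lose Steiner vertices
freely. This allows pruning. -/
theorem HyperFeasible.mono {R U : Set V} {T T' : K → G.Subgraph} {s t : V} {d : ℕ}
    (h : HyperFeasible R U T s t d) (hT : ∀ k, ∀ v ∈ (T k).verts, v ∈ R → v ∈ (T' k).verts)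
    (hs : s ∈ R) : HyperFeasible R U T' s t d := by
  intro N M hsM htM hM hsep
  refine h N M hsM htM hM fun hr => hsep ?_
  have : ∀ v, ReflTransGen (HyperStep R T N M) s v →
      v ∈ R ∧ ReflTransGen (HyperStep R T' N M) s v := by
    intro v hv
    induction hv with
    | refl => exact ⟨hs, .refl⟩
    | tail _ hstep ih =>
      obtain ⟨k, hk, hu, hv, hvR, hvM⟩ := hstep
      exact ⟨hvR, ih.2.tail ⟨k, hk, hT k _ hu ih.1, hT k _ hv hvR, hvR, hvM⟩⟩
  exact (this t hr).2

/-- The adjacency relation for Menger's theorem: `d` copies of the source, the hyperedges, and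
copies of the vertices. -/
def mengerRel (R U : Set V) (T : K → G.Subgraph) (s : V) (d : ℕ) :
    Fin d ⊕ (K ⊕ V × Fin (d + 1)) → Fin d ⊕ (K ⊕ V × Fin (d + 1)) → Prop
  | .inl _, .inr (.inl k) => s ∈ (T k).verts
  | .inr (.inl k), .inr (.inr (v, i)) => v ∈ (T k).verts ∧ v ∈ R ∧ (v ∉ U → i = 0)
  | .inr (.inr (v, _)), .inr (.inl k) => v ∈ (T k).verts
  | _, _ => False

theorem exists_links [Finite K] [Finite V] {R U : Set V} {T : K → G.Subgraph}
    (hT : ∀ k, IsGood R (T k)) {s t : V} {d : ℕ} (h : HyperFeasible R U T s t d) (hst : s ≠ t) :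
    ∃ (κ : Fin d → Set K) (M : Fin d → Set V),
      (∀ i j k, k ∈ κ i → k ∈ κ j → i = j) ∧
      (∀ i j v, v ∈ M i → v ∈ M j → v ∈ U ∨ i = j) ∧
      ∀ j, (linkGraph R T (κ j) ({s, t} ∪ M j)).Reachable s t := by
  classical
  obtain ⟨O, hO, hlink⟩ := exists_linkage (mengerRel R U T s d) (Set.range Sum.inl)
    {y | ∃ k, y = .inr (.inl k) ∧ t ∈ (T k).verts} (by
    intro Z hZ
    have hA : (Set.range (Sum.inl : Fin d → Fin d ⊕ (K ⊕ V × Fin (d + 1)))).ncard = d := by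
      rw [← Set.image_univ, Set.ncard_image_of_injective _ Sum.inl_injective]
      simp
    rw [hA]
    by_contra! hlt
    -- a source that is not in `Z`
    obtain ⟨i₀, hi₀⟩ : ∃ i : Fin d, Sum.inl i ∉ Z := by
      by_contra! hcon
      refine absurd (Set.ncard_le_ncard (s := Set.range Sum.inl) (t := Z) ?_ (Set.toFinite _))
        (by rw [hA]; omega)
      rintro _ ⟨i, rfl⟩
      exact hcon i
    -- Fewer than $d$ elements cannot block all $d+1$ copies, so vertices of $U$ are never cut. A
    -- vertex outside $U$ can be entered only in its copy $0$.
    have hcopy : ∀ v, ∃ i : Fin (d + 1), (Sum.inr (Sum.inr (v, i)) :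
        Fin d ⊕ (K ⊕ V × Fin (d + 1))) ∉ Z := by
      intro v
      by_contra! hcon
      have hinj : Function.Injective (fun i : Fin (d + 1) =>
          (Sum.inr (Sum.inr (v, i)) : Fin d ⊕ (K ⊕ V × Fin (d + 1)))) := by
        intro i j hij
        simpa using hij
      have := Set.ncard_le_ncard (s := Set.range fun i : Fin (d + 1) =>
          (Sum.inr (Sum.inr (v, i)) : Fin d ⊕ (K ⊕ V × Fin (d + 1)))) (t := Z)
        (by rintro _ ⟨i, rfl⟩; exact hcon i) (Set.toFinite _)
      rw [← Set.image_univ, Set.ncard_image_of_injective _ hinj] at this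
      simp at this
      omega
    set N : Set K := {k | Sum.inr (Sum.inl k) ∈ Z} with hN
    set M : Set V := {v | v ∈ R ∧ v ∉ U ∧ v ≠ s ∧ v ≠ t ∧ Sum.inr (Sum.inr (v, 0)) ∈ Z} with hM
    have hcard : N.ncard + M.ncard ≤ Z.ncard := by
      have i1 : Function.Injective
          (fun k : K => (Sum.inr (Sum.inl k) : Fin d ⊕ (K ⊕ V × Fin (d + 1)))) :=
        fun a b hab => by simpa using hab
      have i2 : Function.Injective
          (fun v : V => (Sum.inr (Sum.inr (v, 0)) : Fin d ⊕ (K ⊕ V × Fin (d + 1)))) :=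
        fun a b hab => by simpa using hab
      rw [← Set.ncard_image_of_injective N i1, ← Set.ncard_image_of_injective M i2,
        ← Set.ncard_union_eq ?_ (Set.toFinite _) (Set.toFinite _)]
      · refine Set.ncard_le_ncard ?_ (Set.toFinite _)
        rintro _ (⟨k, hk, rfl⟩ | ⟨v, hv, rfl⟩)
        · exact hk
        · exact hv.2.2.2.2
      · rw [Set.disjoint_left]
        rintro _ ⟨k, hk, rfl⟩ ⟨v, hv, h⟩
        simp at h
    have hreach : ReflTransGen (HyperStep R T N M) s t := by
      by_contra hcon
      have := h N M (fun h => h.2.2.1 rfl) (fun h => h.2.2.2.1 rfl) (fun v hv => ⟨hv.1, hv.2.1⟩) hcon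
      omega
    set F := fun x y => mengerRel R U T s d x y ∧ y ∉ Z with hF
    -- The copies of $s$ and $t$ may lie in `Z`. A walk that returns to $s$ therefore restarts at
    -- the source `i₀`, and one that reaches $t$ stops at the hyperedge before it.
    have key : ∀ v, ReflTransGen (HyperStep R T N M) s v → v = s ∨
        (∃ k, t ∈ (T k).verts ∧ ReflTransGen F (Sum.inl i₀) (Sum.inr (Sum.inl k))) ∨
        (v ≠ t ∧ ∃ i, ReflTransGen F (Sum.inl i₀) (Sum.inr (Sum.inr (v, i)))) := by
      intro v hv
      induction hv with
      | refl => exact Or.inl rfl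
      | @tail u v _ hstep ih =>
        obtain ⟨k, hk, hu, hv, hvR, hvM⟩ := hstep
        have step : ReflTransGen F (Sum.inl i₀) (Sum.inr (Sum.inl k)) → v = s ∨
            (∃ k, t ∈ (T k).verts ∧ ReflTransGen F (Sum.inl i₀) (Sum.inr (Sum.inl k))) ∨
            (v ≠ t ∧ ∃ i, ReflTransGen F (Sum.inl i₀) (Sum.inr (Sum.inr (v, i)))) := by
          intro hr
          by_cases hvs : v = s
          · exact Or.inl hvs
          by_cases hvt : v = t
          · exact Or.inr (Or.inl ⟨k, hvt ▸ hv, hr⟩)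
          refine Or.inr (Or.inr ⟨hvt, ?_⟩)
          by_cases hvU : v ∈ U
          · obtain ⟨i, hi⟩ := hcopy v
            exact ⟨i, hr.tail ⟨⟨hv, hvR, fun h => absurd hvU h⟩, hi⟩⟩
          · exact ⟨0, hr.tail ⟨⟨hv, hvR, fun _ => rfl⟩, fun hz => hvM ⟨hvR, hvU, hvs, hvt, hz⟩⟩⟩
        rcases ih with rfl | h | ⟨-, i, hi⟩
        · exact step (ReflTransGen.refl.tail ⟨hu, hk⟩)
        · exact Or.inr (Or.inl h)
        · exact step (hi.tail ⟨hu, hk⟩)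
    rcases key t hreach with h | ⟨k, hk, hr⟩ | ⟨h, -⟩
    · exact hst h.symm
    · exact hZ _ ⟨i₀, rfl⟩ hi₀ _ ⟨k, rfl, hk⟩ hr
    · exact h rfl)
  refine ⟨fun j => {k | Sum.inr (Sum.inl k) ∈ O (Sum.inl j)},
    fun j => {v | ∃ i, Sum.inr (Sum.inr (v, i)) ∈ O (Sum.inl j) ∧ (v ∉ U → i = 0)}, ?_, ?_, ?_⟩
  · intro i j k hi hj
    exact Sum.inl_injective (hO _ ⟨i, rfl⟩ _ ⟨j, rfl⟩ _ hi hj)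
  · rintro i j v ⟨a, ha, ha0⟩ ⟨b, hb, hb0⟩
    by_cases hv : v ∈ U
    · exact Or.inl hv
    · rw [ha0 hv] at ha
      rw [hb0 hv] at hb
      exact Or.inr (Sum.inl_injective (hO _ ⟨i, rfl⟩ _ ⟨j, rfl⟩ _ ha hb))
  · intro j
    set κ : Set K := {k | Sum.inr (Sum.inl k) ∈ O (Sum.inl j)} with hκ
    set M : Set V := {s, t} ∪ {v | ∃ i, Sum.inr (Sum.inr (v, i)) ∈ O (Sum.inl j) ∧ (v ∉ U → i = 0)}
      with hM
    obtain ⟨_, ⟨k, rfl, hk⟩, hr⟩ := hlink (Sum.inl j) ⟨j, rfl⟩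
    have within : ∀ k ∈ κ, ∀ u ∈ (T k).verts, ∀ w ∈ (T k).verts, u ∈ M → w ∈ M →
        (linkGraph R T κ M).Reachable u w := by
      intro k hk u hu w hw huM hwM
      refine ((hT k).reachable hu hw).mono (linkGraph_mono (by simpa using hk) ?_)
      rintro x (rfl | rfl) <;> assumption
    have hsM : s ∈ M := by simp [hM]
    have htM : t ∈ M := by simp [hM]
    let Good : Fin d ⊕ (K ⊕ V × Fin (d + 1)) → Prop := fun y => match y with
      | .inl _ => True
      | .inr (.inl k) => ∀ u ∈ (T k).verts, u ∈ M → (linkGraph R T κ M).Reachable s u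
      | .inr (.inr (v, _)) => v ∈ M ∧ (linkGraph R T κ M).Reachable s v
    have key : ∀ y, ReflTransGen (fun x y => mengerRel R U T s d x y ∧ x ∈ O (Sum.inl j) ∧
        y ∈ O (Sum.inl j)) (Sum.inl j) y → Good y := by
      intro y hy
      induction hy with
      | refl => trivial
      | @tail x y _ hxy ih =>
        obtain ⟨hE, hx, hy⟩ := hxy
        rcases x with i | k | ⟨v, i⟩ <;> rcases y with i' | k' | ⟨v', i'⟩ <;>
          simp only [mengerRel] at hE
        · exact fun u hu huM => within k' hy s hE u hu hsM huM
        · have hv' : v' ∈ M := Or.inr ⟨i', hy, hE.2.2⟩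
          exact ⟨hv', ih v' hE.1 hv'⟩
        · exact fun u hu huM => ih.2.trans (within k' hy v hE u hu ih.1 huM)
    exact key _ hr t hk htM

end Hypergraph

end SNDP

namespace SNDP

/-! ### Systems of pieces and the effect of minimality -/

section System

open Relation

variable {V K : Type*} {G : SimpleGraph V}

/-- A family of edge-disjoint connected subgraphs of `F` whose hypergraph on `R` respects the
demands `d`. If `D` holds, they share no vertex outside `R`. -/
structure IsSystem (R U : Set V) (D : Prop) (d : V → V → ℕ) (F : SimpleGraph V)
    (T : K → G.Subgraph) : Prop where
  good : ∀ k, IsGood R (T k)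
  edge : ∀ k k' a b, (T k).Adj a b → (T k').Adj a b → k = k'
  steiner : D → ∀ k k' v, v ∉ R → v ∈ (T k).verts → v ∈ (T k').verts → k = k'
  le : ∀ k a b, (T k).Adj a b → F.Adj a b
  feas : ∀ s ∈ R, ∀ t ∈ R, s ≠ t → HyperFeasible R U T s t (d s t)

theorem IsSystem.edgeSet_eq {R U : Set V} {D : Prop} {d : V → V → ℕ} {F : SimpleGraph V}
    {T : K → G.Subgraph} (h : IsSystem R U D d F T) {k k' : K} {e : Sym2 V}
    (he : e ∈ (T k).edgeSet) (he' : e ∈ (T k').edgeSet) : k = k' := by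
  induction e with
  | h a b => exact h.edge k k' a b he he'

theorem IsSystem.exists_paths [Finite V] [Finite K] {R U : Set V} {D : Prop} {d : V → V → ℕ}
    {F : SimpleGraph V} {T : K → G.Subgraph} (h : IsSystem R U D d F T) {s t : V} (hs : s ∈ R)
    (ht : t ∈ R) (hst : s ≠ t) :
    ∃ (κ : Fin (d s t) → Set K) (M : Fin (d s t) → Set V) (P : Fin (d s t) → F.Path s t),
      (∀ i j k, k ∈ κ i → k ∈ κ j → i = j) ∧
      (∀ i j v, v ∈ M i → v ∈ M j → v ∈ U ∨ i = j) ∧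
      (∀ j, ∀ e ∈ (P j).1.edges, ∃ k ∈ κ j, e ∈ (T k).edgeSet) ∧
      ∀ j, ∀ v ∈ (P j).1.support, (v ∈ R → v = s ∨ v = t ∨ v ∈ M j) ∧
        ∃ k ∈ κ j, v ∈ (T k).verts := by
  classical
  obtain ⟨κ, M, hκ, hM, hr⟩ := SNDP.exists_links h.good (h.feas s hs t ht hst) hst
  have hle : ∀ j, linkGraph R T (κ j) ({s, t} ∪ M j) ≤ F :=
    fun j a b hab => by
      obtain ⟨⟨k, -, hk⟩, -⟩ := hab
      exact h.le k a b hk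
  choose p hp using fun j => (hr j).exists_isPath
  have hedge : ∀ j, ∀ a b, s(a, b) ∈ (p j).edges →
      (linkGraph R T (κ j) ({s, t} ∪ M j)).Adj a b :=
    fun j a b hab => (p j).edges_subset_edgeSet hab
  refine ⟨κ, M, fun j => ⟨(p j).mapLe (hle j), (hp j).mapLe (hle j)⟩, hκ, hM, ?_, ?_⟩
  · intro j e he
    rw [SimpleGraph.Walk.edges_mapLe_eq_edges] at he
    induction e with
    | h a b =>
      obtain ⟨⟨k, hk, hab⟩, -⟩ := hedge j a b he
      exact ⟨k, hk, hab⟩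
  · intro j v hv
    rw [SimpleGraph.Walk.support_mapLe_eq_support] at hv
    have hnil : ¬ (p j).Nil := SimpleGraph.Walk.not_nil_of_ne hst
    obtain ⟨e, he, hve⟩ := (SimpleGraph.Walk.mem_support_iff_exists_mem_edges_of_not_nil hnil).1 hv
    obtain ⟨w, rfl⟩ := hve
    obtain ⟨⟨k, hk, hab⟩, hvR, -⟩ := hedge j v w he
    refine ⟨fun hv => ?_, k, hk, (T k).edge_vert hab⟩
    have := hvR hv
    simpa [or_assoc] using this

theorem reachable_coe {T : G.Subgraph} {u w : V} (hu : u ∈ T.verts)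
    (h : T.spanningCoe.Reachable u w) : ∃ hw : w ∈ T.verts, T.coe.Reachable ⟨u, hu⟩ ⟨w, hw⟩ := by
  rw [SimpleGraph.reachable_iff_reflTransGen] at h
  induction h with
  | refl => exact ⟨hu, .rfl⟩
  | @tail x y _ hxy ih =>
    obtain ⟨hx, hr⟩ := ih
    rw [SimpleGraph.Subgraph.spanningCoe_adj] at hxy
    exact ⟨T.edge_vert hxy.symm, hr.trans (SimpleGraph.Adj.reachable hxy)⟩

/-- `T k` cannot be replaced by a smaller subgraph. -/
theorem IsSystem.adj_of_le {R U : Set V} {D : Prop} {d : V → V → ℕ} {F : SimpleGraph V}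
    {T : K → G.Subgraph} (h : IsSystem R U D d F T)
    (hmin : ∀ e ∈ F.edgeSet, ∀ T' : K → G.Subgraph, ¬ IsSystem R U D d (F.deleteEdges {e}) T')
    {k : K} {T' : G.Subgraph} (hT' : T' ≤ T k) (hg : IsGood R T')
    (hv : ∀ v ∈ (T k).verts, v ∈ R → v ∈ T'.verts) {a b : V} (hab : (T k).Adj a b) :
    T'.Adj a b := by
  classical
  by_contra hcon
  have hle : ∀ l, Function.update T k T' l ≤ T l := by
    intro l
    by_cases hl : l = k
    · subst hl; simpa using hT'
    · simp [Function.update_of_ne hl]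
  -- Edge-disjointness means that only `T k` contained $ab$, so the pruned family is a system
  -- without this edge.
  refine hmin s(a, b) (h.le k a b hab) (Function.update T k T') ⟨?_, ?_, ?_, ?_, ?_⟩
  · intro l
    by_cases hl : l = k
    · subst hl; simpa using hg
    · simpa [Function.update_of_ne hl] using h.good l
  · exact fun l l' x y hl hl' => h.edge l l' x y ((hle l).2 hl) ((hle l').2 hl')
  · exact fun hD l l' v hvR hl hl' => h.steiner hD l l' v hvR ((hle l).1 hl) ((hle l').1 hl')
  · intro l x y hl
    rw [SimpleGraph.deleteEdges_adj]
    refine ⟨h.le l x y ((hle l).2 hl), fun hxy => ?_⟩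
    have hab' : (Function.update T k T' l).Adj a b := by
      rw [← SimpleGraph.Subgraph.mem_edgeSet] at hl ⊢
      rwa [← (Set.mem_singleton_iff.1 hxy)]
    obtain rfl : l = k := h.edge l k a b ((hle l).2 hab') hab
    simp only [Function.update_self] at hab'
    exact hcon hab'
  · intro s hs t ht hst
    refine (h.feas s hs t ht hst).mono (fun l v hvl hvR => ?_) hs
    by_cases hl : l = k
    · subst hl; simpa using hv v hvl hvR
    · simpa [Function.update_of_ne hl] using hvl

/-- An edge that is not a bridge could be pruned from `T k`, keeping it connected on the same
vertices. -/
theorem IsSystem.isTree {R U : Set V} {D : Prop} {d : V → V → ℕ} {F : SimpleGraph V}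
    {T : K → G.Subgraph} (h : IsSystem R U D d F T)
    (hmin : ∀ e ∈ F.edgeSet, ∀ T' : K → G.Subgraph, ¬ IsSystem R U D d (F.deleteEdges {e}) T')
    {k : K} (hne : (T k).verts.Nonempty) : (T k).coe.IsTree := by
  obtain ⟨v₀, hv₀⟩ := hne
  have hconn : (T k).coe.Connected := by
    have : Nonempty (T k).verts := ⟨⟨v₀, hv₀⟩⟩
    refine ⟨fun u w => ?_⟩
    exact (reachable_coe u.2 ((h.good k).conn u u.2 w w.2)).2
  refine ⟨hconn, SimpleGraph.isAcyclic_iff_forall_adj_isBridge.2 ?_⟩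
  intro u v huv
  rw [SimpleGraph.isBridge_iff]
  intro hr
  rw [SimpleGraph.Subgraph.coe_adj] at huv
  set T' : G.Subgraph := (T k).deleteEdges {s(u.1, v.1)} with hT'
  have hr' : T'.spanningCoe.Reachable u.1 v.1 := by
    refine hr.map (G' := T'.spanningCoe) ⟨Subtype.val, ?_⟩
    intro a b hab
    rw [SimpleGraph.deleteEdges_adj] at hab
    rw [SimpleGraph.Subgraph.spanningCoe_adj, hT', SimpleGraph.Subgraph.deleteEdges_adj]
    refine ⟨hab.1, fun hmem => hab.2 ?_⟩
    simp only [Set.mem_singleton_iff, Sym2.eq_iff, Subtype.ext_iff] at hmem ⊢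
    exact hmem
  have hle : T' ≤ T k := SimpleGraph.Subgraph.deleteEdges_le _
  have := h.adj_of_le hmin hle ⟨?_, fun r hr x y hx hy => (h.good k).deg r hr x y (hle.2 hx)
    (hle.2 hy)⟩ (fun v hv _ => hv) huv
  · rw [hT', SimpleGraph.Subgraph.deleteEdges_adj] at this
    exact this.2 rfl
  · intro x hx w hw
    have hxw := (h.good k).conn x hx w hw
    rw [SimpleGraph.reachable_iff_reflTransGen] at hxw
    clear hw
    induction hxw with
    | refl => exact .rfl
    | @tail y z _ hyz ih =>
      refine ih.trans ?_
      rw [SimpleGraph.Subgraph.spanningCoe_adj] at hyz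
      by_cases he : s(y, z) = s(u.1, v.1)
      · rcases Sym2.eq_iff.1 he with ⟨rfl, rfl⟩ | ⟨rfl, rfl⟩
        · exact hr'
        · exact hr'.symm
      · refine SimpleGraph.Adj.reachable ?_
        rw [SimpleGraph.Subgraph.spanningCoe_adj, hT', SimpleGraph.Subgraph.deleteEdges_adj]
        exact ⟨hyz, he⟩

/-- Removing a Steiner leaf keeps the subgraph connected and keeps its terminals, so the edge at the
leaf would be superfluous. -/
theorem IsSystem.leaf_mem {R U : Set V} {D : Prop} {d : V → V → ℕ} {F : SimpleGraph V}
    {T : K → G.Subgraph} (h : IsSystem R U D d F T)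
    (hmin : ∀ e ∈ F.edgeSet, ∀ T' : K → G.Subgraph, ¬ IsSystem R U D d (F.deleteEdges {e}) T')
    {k : K} {v : V} (hv : IsLeaf (T k) v) : v ∈ R := by
  by_contra hvR
  obtain ⟨x, hx⟩ := Set.ncard_eq_one.1 hv
  have hadj : ∀ y, (T k).Adj v y ↔ y = x := fun y => by
    rw [← SimpleGraph.Subgraph.mem_neighborSet, hx, Set.mem_singleton_iff]
  have hvx : (T k).Adj v x := (hadj x).2 rfl
  let T' : G.Subgraph :=
    { verts := {y | y ∈ (T k).verts ∧ y ≠ v}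
      Adj := fun a b => (T k).Adj a b ∧ a ≠ v ∧ b ≠ v
      adj_sub := fun h => (T k).adj_sub h.1
      edge_vert := fun h => ⟨(T k).edge_vert h.1, h.2.1⟩
      symm := ⟨fun _ _ h => ⟨h.1.symm, h.2.2, h.2.1⟩⟩ }
  have hle : T' ≤ T k := ⟨fun y hy => hy.1, fun a b hab => hab.1⟩
  have hT' : T'.Adj v x := by
    refine h.adj_of_le hmin hle ⟨?_, fun r hr x y hx hy => (h.good k).deg r hr x y (hle.2 hx)
      (hle.2 hy)⟩ (fun y hy hyR => ⟨hy, fun hyv => hvR (hyv ▸ hyR)⟩) hvx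
    rintro u ⟨hu, huv⟩ w ⟨hw, hwv⟩
    have key : ∀ u, (T k).spanningCoe.Reachable u w →
        (u ≠ v → T'.spanningCoe.Reachable u w) ∧ (u = v → T'.spanningCoe.Reachable x w) := by
      intro u hu
      rw [SimpleGraph.reachable_iff_reflTransGen] at hu
      induction hu using ReflTransGen.head_induction_on with
      | refl => exact ⟨fun _ => .rfl, fun h => absurd h hwv⟩
      | @head a b hab _ ih =>
        rw [SimpleGraph.Subgraph.spanningCoe_adj] at hab
        refine ⟨fun ha => ?_, fun ha => ?_⟩
        · by_cases hb : b = v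
          · obtain rfl : a = x := (hadj a).1 (hb ▸ hab.symm)
            exact ih.2 hb
          · have : T'.spanningCoe.Adj a b := ⟨hab, ha, hb⟩
            exact this.reachable.trans (ih.1 hb)
        · subst ha
          obtain rfl : b = x := (hadj b).1 hab
          exact ih.1 hab.ne.symm
    exact (key u ((h.good k).conn u hu w hw)).1 huv
  exact hT'.2.1 rfl

theorem IsGood.not_internal {R : Set V} {T : G.Subgraph} (h : IsGood R T) {v : V}
    (hv : IsInternal T v) : v ∉ R := by
  intro hvR
  have : (T.neighborSet v).Subsingleton := fun x hx y hy => h.deg v hvR x y hx hy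
  have : Finite (T.neighborSet v) := this.finite
  have h1 := Set.ncard_le_one_iff_subsingleton.2 ‹(T.neighborSet v).Subsingleton›
  have h2 : 2 ≤ (T.neighborSet v).ncard := hv
  omega

theorem singletonSubgraph_isTree (v : V) : (G.singletonSubgraph v).coe.IsTree :=
  SimpleGraph.IsTree.of_subsingleton

/-- The family of the trees of a minimal system and of the isolated vertices. -/
theorem IsSystem.exists_treeDecomposition [Finite V] [Finite K] {R U : Set V} {D : Prop}
    {d : V → V → ℕ} {H : G.Subgraph} {T : K → G.Subgraph}
    (h : IsSystem R U D d H.spanningCoe T)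
    (hmin : ∀ e ∈ H.spanningCoe.edgeSet, ∀ T' : K → G.Subgraph,
      ¬ IsSystem R U D d (H.spanningCoe.deleteEdges {e}) T') :
    ∃ (b : ℕ) (S : Fin b → G.Subgraph), IsTreeDecomposition R H S ∧ Function.Injective S ∧
      (∀ i j, i ≠ j → Disjoint (S i).edgeSet (S j).edgeSet) ∧
      (D → ∀ i j, i ≠ j → ∀ v, v ∈ (S i).verts → v ∈ (S j).verts → v ∈ R) ∧
      ∀ i, (S i).edgeSet = ∅ ∨ ∃ k, S i = T k := by
  classical
  -- Edgeless members are discarded because they may coincide. The isolated vertices of `H` are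
  -- added so that the union is all of `H`.
  let ι := {k : K // (T k).edgeSet.Nonempty} ⊕ {v : V // v ∈ H.verts ∧ ∀ w, ¬ H.Adj v w}
  obtain ⟨b, ⟨φ⟩⟩ := Finite.exists_equiv_fin ι
  let S' : ι → G.Subgraph := Sum.elim (fun k => T k.1) (fun v => G.singletonSubgraph v.1)
  -- every vertex of a nontrivial member has a neighbour
  have hnbr : ∀ k, (T k).edgeSet.Nonempty → ∀ v ∈ (T k).verts, ∃ w, (T k).Adj v w := by
    rintro k ⟨e, he⟩ v hv
    induction e with
    | h a b =>
      have hab : (T k).Adj a b := he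
      have hr := (h.good k).conn v hv a ((T k).edge_vert hab)
      rw [SimpleGraph.reachable_iff_reflTransGen] at hr
      rcases hr.cases_head with rfl | ⟨c, hc, -⟩
      · exact ⟨b, hab⟩
      · exact ⟨c, hc⟩
  have hcov : ∀ a b, H.Adj a b → ∃ k, (T k).Adj a b := by
    intro a b hab
    by_contra! hcon
    refine hmin s(a, b) hab T ⟨h.good, h.edge, h.steiner, ?_, h.feas⟩
    intro k x y hxy
    rw [SimpleGraph.deleteEdges_adj]
    refine ⟨h.le k x y hxy, fun he => hcon k ?_⟩
    rw [← SimpleGraph.Subgraph.mem_edgeSet] at hxy ⊢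
    rwa [← Set.mem_singleton_iff.1 he]
  have hinj : Function.Injective S' := by
    rintro (⟨k, hk⟩ | ⟨v, hv⟩) (⟨k', hk'⟩ | ⟨v', hv'⟩) heq
    · replace heq : T k = T k' := heq
      obtain ⟨e, he⟩ := id hk
      have he' : e ∈ (T k').edgeSet := heq ▸ he
      obtain rfl := h.edgeSet_eq he he'
      rfl
    · have heq : T k = G.singletonSubgraph v' := heq
      simp [heq] at hk
    · have heq : G.singletonSubgraph v = T k' := heq
      simp [← heq] at hk'
    · have heq : G.singletonSubgraph v = G.singletonSubgraph v' := heq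
      have : v ∈ (G.singletonSubgraph v').verts := heq ▸ rfl
      obtain rfl : v = v' := this
      rfl
  have hisol : ∀ (k : K) (v : V), (T k).edgeSet.Nonempty → (∀ w, ¬ H.Adj v w) →
      v ∉ (T k).verts := by
    intro k v hk hv hvk
    obtain ⟨w, hw⟩ := hnbr k hk v hvk
    exact hv w (h.le k v w hw)
  refine ⟨b, S' ∘ φ.symm, ⟨?_, ?_⟩, hinj.comp φ.symm.injective, ?_, ?_, ?_⟩
  · have hsup : H = ⨆ i, S' i := by
      apply SimpleGraph.Subgraph.ext
      · ext v
        rw [SimpleGraph.Subgraph.verts_iSup, Set.mem_iUnion]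
        constructor
        · intro hv
          by_cases hw : ∃ w, H.Adj v w
          · obtain ⟨w, hw⟩ := hw
            obtain ⟨k, hk⟩ := hcov v w hw
            exact ⟨.inl ⟨k, s(v, w), hk⟩, (T k).edge_vert hk⟩
          · exact ⟨.inr ⟨v, hv, not_exists.1 hw⟩, rfl⟩
        · rintro ⟨⟨k, hk⟩ | ⟨v', hv'⟩, hv⟩
          · obtain ⟨w, hw⟩ := hnbr k hk v hv
            exact H.edge_vert (h.le k v w hw)
          · obtain rfl : v = v' := hv
            exact hv'.1
      · ext a b
        rw [SimpleGraph.Subgraph.iSup_adj]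
        constructor
        · intro hab
          obtain ⟨k, hk⟩ := hcov a b hab
          exact ⟨.inl ⟨k, s(a, b), hk⟩, hk⟩
        · rintro ⟨⟨k, hk⟩ | ⟨v', hv'⟩, hv⟩
          · exact h.le k a b hv
          · simp [S'] at hv
    rw [hsup]
    exact (φ.symm.surjective.iSup_comp S').symm
  · intro i
    change (S' (φ.symm i)).coe.IsTree ∧ (∀ v, IsLeaf (S' (φ.symm i)) v → v ∈ R) ∧
      ∀ v, IsInternal (S' (φ.symm i)) v → v ∉ R
    rcases φ.symm i with ⟨k, hk⟩ | ⟨v, hv⟩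
    · refine ⟨h.isTree hmin ?_, fun v hv => h.leaf_mem hmin hv,
        fun v hv => (h.good k).not_internal hv⟩
      obtain ⟨e, he⟩ := hk
      induction e with
      | h a b => exact ⟨a, (T k).edge_vert he⟩
    · have hns : ∀ w, ((S' (.inr ⟨v, hv⟩)).neighborSet w).ncard = 0 := fun w => by simp [S']
      refine ⟨?_, fun w hw => ?_, fun w hw => ?_⟩
      · exact singletonSubgraph_isTree v
      · have : ((S' (.inr ⟨v, hv⟩)).neighborSet w).ncard = 1 := hw
        rw [hns] at this
        omega
      · have : 2 ≤ ((S' (.inr ⟨v, hv⟩)).neighborSet w).ncard := hw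
        rw [hns] at this
        omega
  · intro i j hij
    have hij' : φ.symm i ≠ φ.symm j := fun h => hij (φ.symm.injective h)
    change Disjoint (S' (φ.symm i)).edgeSet (S' (φ.symm j)).edgeSet
    generalize φ.symm i = x at hij' ⊢
    generalize φ.symm j = y at hij' ⊢
    rcases x with ⟨k, hk⟩ | ⟨v, hv⟩ <;> rcases y with ⟨k', hk'⟩ | ⟨v', hv'⟩
    · rw [Set.disjoint_left]
      intro e he he'
      obtain rfl := h.edgeSet_eq he he'
      exact hij' rfl
    all_goals simp [S']
  · intro hD i j hij v hi hj
    have hij' : φ.symm i ≠ φ.symm j := fun h => hij (φ.symm.injective h)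
    change v ∈ (S' (φ.symm i)).verts at hi
    change v ∈ (S' (φ.symm j)).verts at hj
    generalize φ.symm i = x at hij' hi
    generalize φ.symm j = y at hij' hj
    rcases x with ⟨k, hk⟩ | ⟨u, hu⟩ <;> rcases y with ⟨k', hk'⟩ | ⟨u', hu'⟩
    · by_contra hvR
      obtain rfl := h.steiner hD k k' v hvR hi hj
      exact hij' rfl
    · obtain rfl : v = u' := hj
      exact absurd hi (hisol k v hk hu'.2)
    · obtain rfl : v = u := hi
      exact absurd hj (hisol k' v hk' hu.2)
    · obtain rfl : v = u := hi
      obtain rfl : v = u' := hj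
      exact absurd rfl hij'
  · intro i
    change (S' (φ.symm i)).edgeSet = ∅ ∨ ∃ k, S' (φ.symm i) = T k
    rcases φ.symm i with ⟨k, hk⟩ | ⟨v, hv⟩
    · exact Or.inr ⟨k, rfl⟩
    · exact Or.inl (by simp [S'])

end System

end SNDP

namespace SNDP

/-! ### From contracted incidence graphs to pieces -/

section Incidence

open Relation

/-- The nodes of the incidence graph: copies of the vertices, and edges. -/
abbrev Node (V ι : Type*) := (V × ι) ⊕ Sym2 V

variable {V ι : Type*}

/-- The incidence graph of `F`, with `ι` many copies of each vertex outside `R`. -/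
def incGraph (ι : Type*) [Inhabited ι] (R : Set V) (F : SimpleGraph V) :
    SimpleGraph (Node V ι) where
  Adj x y := match x, y with
    | .inl (v, i), .inr e => e ∈ F.edgeSet ∧ v ∈ e ∧ (v ∈ R → i = default)
    | .inr e, .inl (v, i) => e ∈ F.edgeSet ∧ v ∈ e ∧ (v ∈ R → i = default)
    | _, _ => False
  symm := ⟨by rintro (⟨v, i⟩ | e) (⟨w, j⟩ | e') h <;> exact h⟩
  loopless := ⟨by rintro (⟨v, i⟩ | e) h <;> exact h⟩

/-- The node of a vertex in `R`. -/
def root (ι : Type*) [Inhabited ι] (v : V) : Node V ι := .inl (v, default)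

/-- Some copy of `v` is adjacent to the edge `e`. -/
def Touches (Γ : SimpleGraph (Node V ι)) (v : V) (e : Sym2 V) : Prop :=
  ∃ i, Γ.Adj (.inl (v, i)) (.inr e)

open Classical in
/-- A chosen edge of colour `k` at the vertex `r`. -/
noncomputable def anchor (Γ : SimpleGraph (Node V ι)) (c : Node V ι → Node V ι) (k : Node V ι)
    (r : V) : Sym2 V :=
  if h : ∃ e, Touches Γ r e ∧ c (.inr e) = k then h.choose else s(r, r)

/-- The vertices of the colour class `k`. -/
def pieceVerts (R : Set V) (Γ : SimpleGraph (Node V ι)) (c : Node V ι → Node V ι)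
    (k : Node V ι) : Set V :=
  {v | (v ∉ R ∧ ∃ i, c (.inl (v, i)) = k) ∨ (v ∈ R ∧ ∃ e, Touches Γ v e ∧ c (.inr e) = k)}

theorem anchor_spec {R : Set V} {Γ : SimpleGraph (Node V ι)}
    {c : Node V ι → Node V ι} {k : Node V ι} {r : V} (hr : r ∈ R) (h : r ∈ pieceVerts R Γ c k) :
    Touches Γ r (anchor Γ c k r) ∧ c (.inr (anchor Γ c k r)) = k := by
  rcases h with h | ⟨-, h⟩
  · exact absurd hr h.1
  · rw [anchor, dif_pos h]
    exact h.choose_spec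

variable [Inhabited ι]

theorem root_injective : Function.Injective (root (V := V) ι) := fun v w h => by
  simpa [root] using h

/-- The demands, as a function of the nodes. -/
def nodeDemand (ι : Type*) (d : V → V → ℕ) : Node V ι → Node V ι → ℕ
  | .inl (v, _), .inl (w, _) => d v w
  | _, _ => 0

theorem inr_notMem_root (R : Set V) (e : Sym2 V) : (Sum.inr e : Node V ι) ∉ root ι '' R := by
  rintro ⟨v, -, h⟩
  simp [root] at h

theorem inl_notMem_root {R : Set V} {v : V} (hv : v ∉ R) (i : ι) :
    (Sum.inl (v, i) : Node V ι) ∉ root ι '' R := by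
  rintro ⟨w, hw, h⟩
  simp only [root, Sum.inl.injEq, Prod.mk.injEq] at h
  exact hv (h.1 ▸ hw)

/-- The subgraph that is formed by the colour class `k`, with one edge for each vertex in `R`. -/
def piece {G F : SimpleGraph V} (hF : F ≤ G) (R : Set V) (Γ : SimpleGraph (Node V ι))
    (c : Node V ι → Node V ι) (k : Node V ι) : G.Subgraph where
  verts := pieceVerts R Γ c k
  Adj u v := F.Adj u v ∧ c (.inr s(u, v)) = k ∧ (u ∈ pieceVerts R Γ c k ∧ v ∈ pieceVerts R Γ c k) ∧
    (u ∈ R → anchor Γ c k u = s(u, v)) ∧ (v ∈ R → anchor Γ c k v = s(u, v))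
  adj_sub h := hF h.1
  edge_vert h := h.2.2.1.1
  symm := ⟨fun u v h => ⟨h.1.symm, by rw [Sym2.eq_swap]; exact h.2.1, h.2.2.1.symm,
    fun hv => by rw [h.2.2.2.2 hv, Sym2.eq_swap], fun hu => by rw [h.2.2.2.1 hu, Sym2.eq_swap]⟩⟩

variable {G F : SimpleGraph V} {R U : Set V} {Γ : SimpleGraph (Node V ι)}
  {c : Node V ι → Node V ι}

theorem Touches.spec (hΓ : Γ ≤ incGraph ι R F) {v : V} {e : Sym2 V} (h : Touches Γ v e) :
    e ∈ F.edgeSet ∧ v ∈ e ∧ (v ∈ R → Γ.Adj (root ι v) (.inr e)) := by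
  obtain ⟨i, hi⟩ := h
  have h' : e ∈ F.edgeSet ∧ v ∈ e ∧ (v ∈ R → i = default) := hΓ hi
  refine ⟨h'.1, h'.2.1, fun hv => ?_⟩
  have := h'.2.2 hv
  subst this
  exact hi

theorem Touches.mem_pieceVerts
    (hmono : ∀ x y, Γ.Adj x y → x ∉ root ι '' R → y ∉ root ι '' R → c x = c y)
    {v : V} {e : Sym2 V} (h : Touches Γ v e) : v ∈ pieceVerts R Γ c (c (.inr e)) := by
  by_cases hv : v ∈ R
  · exact Or.inr ⟨hv, e, h, rfl⟩
  · obtain ⟨i, hi⟩ := h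
    exact Or.inl ⟨hv, i, hmono _ _ hi (inl_notMem_root hv i) (inr_notMem_root R e)⟩

theorem piece_adj (hF : F ≤ G) (hΓ : Γ ≤ incGraph ι R F)
    (hmono : ∀ x y, Γ.Adj x y → x ∉ root ι '' R → y ∉ root ι '' R → c x = c y)
    {u v : V} {e : Sym2 V} (hu : Touches Γ u e) (hv : Touches Γ v e) (huv : u ≠ v)
    (huR : u ∈ R → anchor Γ c (c (.inr e)) u = e) (hvR : v ∈ R → anchor Γ c (c (.inr e)) v = e) :
    (piece hF R Γ c (c (.inr e))).Adj u v := by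
  obtain rfl : e = s(u, v) := (Sym2.mem_and_mem_iff huv).1 ⟨(hu.spec hΓ).2.1, (hv.spec hΓ).2.1⟩
  exact ⟨(hu.spec hΓ).1, rfl, ⟨hu.mem_pieceVerts hmono, hv.mem_pieceVerts hmono⟩, huR, hvR⟩

/-- A monochromatic walk alternates between vertex copies and edge nodes. At Steiner vertices the
anchor condition is void, so each edge node passed gives an edge of the piece. At an edge node the
induction speaks of all Steiner vertices touching it. -/
theorem piece_reachable_of_notMem (hF : F ≤ G) (hΓ : Γ ≤ incGraph ι R F)
    (hc : IsContraction Γ (root ι '' R) c)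
    (hmono : ∀ x y, Γ.Adj x y → x ∉ root ι '' R → y ∉ root ι '' R → c x = c y)
    {u v : V} {i j : ι} (huv : c (.inl (u, i)) = c (.inl (v, j))) :
    (piece hF R Γ c (c (.inl (u, i)))).spanningCoe.Reachable u v := by
  have hr := hc.reach _ _ huv
  rw [SimpleGraph.reachable_iff_reflTransGen] at hr
  have key : ∀ x, ReflTransGen (monoGraph Γ (root ι '' R) c).Adj (.inl (u, i)) x →
      c x = c (.inl (u, i)) ∧
      (∀ v j, x = .inl (v, j) →
        (piece hF R Γ c (c (.inl (u, i)))).spanningCoe.Reachable u v) ∧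
      ∀ e, x = .inr e → ∀ w, w ∉ R → Touches Γ w e →
        (piece hF R Γ c (c (.inl (u, i)))).spanningCoe.Reachable u w := by
    intro x hx
    induction hx with
    | refl =>
      refine ⟨rfl, ?_, ?_⟩
      · rintro v j h
        obtain ⟨rfl, -⟩ : u = v ∧ i = j := by simpa using h
        exact .rfl
      · rintro e h
        simp at h
    | @tail x y _ hxy ih =>
      obtain ⟨hcx, ih1, ih2⟩ := ih
      refine ⟨hxy.2.2.2.symm.trans hcx, ?_, ?_⟩
      · rintro v j rfl
        rcases x with ⟨w, l⟩ | e
        · exact absurd (hΓ hxy.1) (by simp [incGraph])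
        · have ht : Touches Γ v e := ⟨j, hxy.1.symm⟩
          refine ih2 e rfl v (fun hv => hxy.2.2.1 ⟨v, hv, ?_⟩) ht
          have h' : e ∈ F.edgeSet ∧ v ∈ e ∧ (v ∈ R → j = default) := hΓ hxy.1
          rw [h'.2.2 hv, root]
      · rintro e rfl w hw ht
        rcases x with ⟨v, l⟩ | e'
        · have hv := ih1 v l rfl
          have htv : Touches Γ v e := ⟨l, hxy.1⟩
          by_cases hvw : v = w
          · exact hvw ▸ hv
          have hvR : v ∉ R := by
            intro hv
            have h' : e ∈ F.edgeSet ∧ v ∈ e ∧ (v ∈ R → l = default) := hΓ hxy.1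
            exact hxy.2.1 ⟨v, hv, by rw [h'.2.2 hv, root]⟩
          have hce : c (.inr e) = c (.inl (u, i)) := hxy.2.2.2.symm.trans hcx
          refine hv.trans (SimpleGraph.Adj.reachable ?_)
          rw [← hce]
          exact piece_adj hF hΓ hmono htv ht hvw (fun h => absurd h hvR) (fun h => absurd h hw)
        · exact absurd (hΓ hxy.1) (by simp [incGraph])
  exact (key _ hr).2.1 v j rfl

/-- An edge node is alone in its class or adjacent to a vertex outside `R`. -/
theorem exists_touches_of_colour_eq (hΓ : Γ ≤ incGraph ι R F)
    (hc : IsContraction Γ (root ι '' R) c) {e : Sym2 V} {x : Node V ι}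
    (h : c (.inr e) = c x) : x = .inr e ∨ ∃ v, v ∉ R ∧ Touches Γ v e := by
  have hr := hc.reach _ _ h
  rw [SimpleGraph.reachable_iff_reflTransGen] at hr
  rcases hr.cases_head with h | ⟨y, hy, -⟩
  · exact Or.inl h.symm
  · rcases y with ⟨v, i⟩ | e'
    · refine Or.inr ⟨v, fun hv => hy.2.2.1 ⟨v, hv, ?_⟩, i, hy.1.symm⟩
      have h' : e ∈ F.edgeSet ∧ v ∈ e ∧ (v ∈ R → i = default) := hΓ hy.1
      rw [h'.2.2 hv, root]
    · exact absurd (hΓ hy.1) (by simp [incGraph])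

theorem piece_isGood (hF : F ≤ G) (hΓ : Γ ≤ incGraph ι R F)
    (hc : IsContraction Γ (root ι '' R) c)
    (hmono : ∀ x y, Γ.Adj x y → x ∉ root ι '' R → y ∉ root ι '' R → c x = c y)
    (k : Node V ι) : IsGood R (piece hF R Γ c k) := by
  refine ⟨fun u hu w hw => ?_, fun r hr x y hx hy => ?_⟩
  -- If the class contains a copy of a Steiner vertex, the anchor edge of each terminal in the piece
  -- leads to a Steiner vertex. Otherwise the anchors of any two terminals in the piece are the same
  -- edge, which joins them.
  · by_cases hst : ∃ v, v ∉ R ∧ ∃ i, c (.inl (v, i)) = k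
    · have near : ∀ u ∈ pieceVerts R Γ c k, ∃ v, v ∉ R ∧ (∃ i, c (.inl (v, i)) = k) ∧
          (piece hF R Γ c k).spanningCoe.Reachable u v := by
        intro u hu
        by_cases huR : u ∈ R
        · obtain ⟨ht, hk⟩ := anchor_spec huR hu
          obtain ⟨v, hv, i, hvi⟩ := hst
          rcases exists_touches_of_colour_eq hΓ hc (hk.trans hvi.symm) with h | ⟨z, hz, hzt⟩
          · simp at h
          · have hzu : u ≠ z := fun h => hz (h ▸ huR)
            have hadj := piece_adj hF hΓ hmono ht hzt hzu (fun _ => by rw [hk])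
              (fun h => absurd h hz)
            have hmem := hzt.mem_pieceVerts hmono
            rw [hk] at hadj hmem
            rcases hmem with h | h
            · exact ⟨z, hz, h.2, SimpleGraph.Adj.reachable hadj⟩
            · exact absurd h.1 hz
        · rcases hu with h | h
          · exact ⟨u, huR, h.2, .rfl⟩
          · exact absurd h.1 huR
      obtain ⟨u', -, ⟨i, hi⟩, hru⟩ := near u hu
      obtain ⟨w', -, ⟨j, hj⟩, hrw⟩ := near w hw
      have := piece_reachable_of_notMem hF hΓ hc hmono (u := u') (v := w') (hi.trans hj.symm)
      rw [hi] at this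
      exact hru.trans (this.trans hrw.symm)
    · push Not at hst
      have hR : ∀ u ∈ pieceVerts R Γ c k, u ∈ R := by
        rintro u (⟨hu, i, hi⟩ | h)
        · exact absurd hi (hst u hu i)
        · exact h.1
      obtain ⟨htu, hku⟩ := anchor_spec (hR u hu) hu
      obtain ⟨htw, hkw⟩ := anchor_spec (hR w hw) hw
      by_cases huw : u = w
      · subst huw; exact .rfl
      rcases exists_touches_of_colour_eq hΓ hc (hku.trans hkw.symm) with h | ⟨z, hz, hzt⟩
      · have h : anchor Γ c k w = anchor Γ c k u := by simpa using h
        rw [h] at htw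
        have := piece_adj hF hΓ hmono htu htw huw (fun _ => by rw [hku]) (fun _ => by rw [hku, h])
        rw [hku] at this
        exact SimpleGraph.Adj.reachable this
      · have := hzt.mem_pieceVerts hmono
        rw [hku] at this
        exact absurd (hR z this) hz
  · have h := (hx.2.2.2.1 hr).symm.trans (hy.2.2.2.1 hr)
    exact Sym2.congr_right.1 h

/-- A hypergraph separator $(N,M)$ lifts to the contracted incidence graph: `A` consists of the
reached terminals and the unblocked classes meeting them, and `B` of everything else that is not
blocked. The remaining nodes are counted by $|N|+|M|$. -/
theorem piece_hyperFeasible [Finite V] [Fintype (Node V ι)] [DecidableEq (Node V ι)] (hF : F ≤ G)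
    (hUR : U ⊆ R) (hΓ : Γ ≤ incGraph ι R F) (hc : IsContraction Γ (root ι '' R) c)
    (hmono : ∀ x y, Γ.Adj x y → x ∉ root ι '' R → y ∉ root ι '' R → c x = c y)
    {d : V → V → ℕ} (hf : SepFeasible Γ (root ι '' R) (root ι '' U) (nodeDemand ι d) c)
    {s t : V} (hs : s ∈ R) (ht : t ∈ R) (hst : s ≠ t) :
    HyperFeasible R U (piece hF R Γ c) s t (d s t) := by
  classical
  intro N M hsM htM hM hsep
  set Q := root ι '' R with hQ
  set ρ : Set V := {v | ReflTransGen (HyperStep R (piece hF R Γ c) N M) s v} with hρ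
  have hρR : ∀ v ∈ ρ, v ∈ R ∧ v ∉ M := by
    intro v hv
    rcases hv.cases_tail with rfl | ⟨u, -, k, -, -, -, hvR, hvM⟩
    · exact ⟨hs, hsM⟩
    · exact ⟨hvR, hvM⟩
  let pA : Node V ι → Prop := fun x => (∃ v ∈ ρ, x = root ι v) ∨
    (x ∉ Q ∧ x ∉ N ∧ ∃ v ∈ ρ, v ∈ pieceVerts R Γ c x)
  let pN : Node V ι → Prop := fun x => (x ∉ Q ∧ x ∈ N) ∨ ∃ v ∈ M, x = root ι v
  have hroot : ∀ v ∈ R, root ι v ∈ Q := fun v hv => ⟨v, hv, rfl⟩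
  have hA_root : ∀ v ∈ R, pA (root ι v) → v ∈ ρ := by
    rintro v hv (⟨w, hw, h⟩ | ⟨h, -⟩)
    · exact root_injective h ▸ hw
    · exact absurd (hroot v hv) h
  have hN_root : ∀ v ∈ R, pN (root ι v) → v ∈ M := by
    rintro v hv (⟨h, -⟩ | ⟨w, hw, h⟩)
    · exact absurd (hroot v hv) h
    · exact root_injective h ▸ hw
  have hAN : ∀ x, pA x → ¬ pN x := by
    rintro x (⟨v, hv, rfl⟩ | ⟨hxQ, hxN, -⟩) hN
    · exact (hρR v hv).2 (hN_root v (hρR v hv).1 hN)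
    · rcases hN with h | ⟨v, hv, rfl⟩
      · exact hxN h.2
      · exact hxQ (hroot v (hM v hv).1)
  set A := Finset.univ.filter pA with hA
  set B := Finset.univ.filter (fun x => ¬ pA x ∧ ¬ pN x) with hB
  have mA : ∀ x, x ∈ A ↔ pA x := fun x => by simp [hA]
  have mB : ∀ x, x ∈ B ↔ ¬ pA x ∧ ¬ pN x := fun x => by simp [hB]
  have hcQ : ∀ e, c (Sum.inr e) ∉ Q := fun e h => inr_notMem_root R e (hc.mem _ h)
  have hfix : ∀ v ∈ R, c (root ι v) = root ι v := fun v hv => hc.fix _ (hroot v hv)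
  have hstep : ∀ v e, v ∈ R → Touches Γ v e → (c (root ι v) ∈ A → c (.inr e) ∉ B) ∧
      (c (.inr e) ∈ A → c (root ι v) ∉ B) := by
    intro v e hv hte
    have hmem := hte.mem_pieceVerts hmono
    rw [hfix v hv, mA, mB, mA, mB]
    refine ⟨fun h1 h2 => h2.1 (Or.inr ⟨hcQ e, fun h => h2.2 (Or.inl ⟨hcQ e, h⟩), v,
      hA_root v hv h1, hmem⟩), fun h1 h2 => ?_⟩
    rcases h1 with ⟨w, hw, h⟩ | ⟨-, hkN, w, hw, hwk⟩
    · exact hcQ e (h ▸ hroot w (hρR w hw).1)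
    · refine h2.1 (Or.inl ⟨v, ?_, rfl⟩)
      refine ReflTransGen.tail hw ⟨_, hkN, hwk, hmem, hv, fun hvM => h2.2 (Or.inr ⟨v, hvM, rfl⟩)⟩
  have hsepAB : IsSep (ColourRel Γ c) (root ι '' U) (root ι s) (root ι t) A B := by
    refine ⟨fun x hx hx' => ((mB x).1 hx').1 ((mA x).1 hx),
      (mA _).2 (Or.inl ⟨s, .refl, rfl⟩), (mB _).2 ⟨fun h => hsep (hA_root t ht h),
        fun h => htM (hN_root t ht h)⟩, ?_, ?_⟩
    · rintro _ hx _ hy ⟨a, b, hab, rfl, rfl⟩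
      by_cases hQ' : a ∈ Q ∨ b ∈ Q
      · rcases hQ' with ⟨v, hv, rfl⟩ | ⟨v, hv, rfl⟩
        · rcases b with b | e
          · exact absurd (hΓ hab) (by simp [incGraph, root])
          · exact (hstep v e hv ⟨_, hab⟩).1 hx hy
        · rcases a with a | e
          · exact absurd (hΓ hab) (by simp [incGraph, root])
          · exact (hstep v e hv ⟨_, hab.symm⟩).2 hx hy
      · push Not at hQ'
        rw [← hmono a b hab hQ'.1 hQ'.2] at hy
        exact ((mB _).1 hy).1 ((mA _).1 hx)
    · rintro _ ⟨v, hv, rfl⟩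
      rw [mA, mB]
      by_cases h : pA (root ι v)
      · exact Or.inl h
      · exact Or.inr ⟨h, fun h' => (hM v (hN_root v (hUR hv) h')).2 hv⟩
  have hle : d s t ≤ (A ∪ B)ᶜ.card :=
    hf _ (hroot s hs) _ (hroot t ht) (fun h => hst (root_injective h)) A B hsepAB
  refine hle.trans ?_
  rw [← Set.ncard_coe_finset, ← Set.ncard_image_of_injective M (root_injective (ι := ι))]
  refine (Set.ncard_le_ncard (t := N ∪ root ι '' M) ?_ (Set.toFinite _)).trans
    (Set.ncard_union_le _ _)
  intro x hx
  have : pN x := by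
    by_contra hN
    refine Finset.mem_compl.1 hx (Finset.mem_union.2 ?_)
    by_cases h : pA x
    · exact Or.inl ((mA x).2 h)
    · exact Or.inr ((mB x).2 ⟨h, hN⟩)
  rcases this with h | ⟨v, hv, rfl⟩
  · exact Or.inl h.2
  · exact Or.inr ⟨v, hv, rfl⟩

end Incidence

end SNDP

namespace SNDP

/-! ### Translating between paths and systems -/

section Paths

variable {V ι : Type*}

/-- The path, routed through the `i`-th copies of its Steiner vertices, starts in `A` and ends in
`B`, so it must hit the separator. -/
theorem exists_mem_separator [Inhabited ι] [Fintype (Node V ι)] [DecidableEq (Node V ι)]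
    {F : SimpleGraph V} {R U : Set V} {s t : V} (hs : s ∈ R) (ht : t ∈ R)
    {A B : Finset (Node V ι)}
    (hsep : IsSep (ColourRel (incGraph ι R F) id) (root ι '' U) (root ι s) (root ι t) A B)
    (P : F.Path s t) (i : ι) :
    ∃ x ∈ (A ∪ B)ᶜ, (∃ e ∈ P.1.edges, x = .inr e) ∨
      ∃ v ∈ P.1.support, (v ∈ R → x = root ι v ∧ v ≠ s ∧ v ≠ t ∧ v ∉ U) ∧
        (v ∉ R → x = .inl (v, i)) := by
  classical
  let node : V → Node V ι := fun v => if v ∈ R then root ι v else .inl (v, i)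
  have hR : ∀ v ∈ R, node v = root ι v := fun v hv => if_pos hv
  have hnR : ∀ v, v ∉ R → node v = .inl (v, i) := fun v hv => if_neg hv
  by_contra! hcon
  have hadj : ∀ v e, e ∈ F.edgeSet → v ∈ e → (incGraph ι R F).Adj (node v) (.inr e) := by
    intro v e he hve
    by_cases hv : v ∈ R
    · rw [hR v hv]; exact ⟨he, hve, fun _ => rfl⟩
    · rw [hnR v hv]; exact ⟨he, hve, fun h => absurd h hv⟩
  have hnode : ∀ v ∈ P.1.support, node v ∈ A ∪ B := by
    intro v hv
    by_contra hx
    obtain ⟨-, h⟩ := hcon (node v) (Finset.mem_compl.2 hx)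
    by_cases hvR : v ∈ R
    · rw [hR v hvR, Finset.mem_union, not_or] at hx
      refine (h v hv fun _ => ⟨hR v hvR, ?_, ?_, ?_⟩).1 hvR
      · rintro rfl; exact hx.1 hsep.left
      · rintro rfl; exact hx.2 hsep.right
      · exact fun hvU => (hsep.cover _ ⟨v, hvU, rfl⟩).elim hx.1 hx.2
    · exact (h v hv fun h' => absurd h' hvR).2 (hnR v hvR)
  have hedge : ∀ e ∈ P.1.edges, (Sum.inr e : Node V ι) ∈ A ∪ B := by
    intro e he
    by_contra hx
    exact (hcon (.inr e) (Finset.mem_compl.2 hx)).1 e he rfl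
  have key : ∀ u (p : F.Walk u t), (∀ v ∈ p.support, node v ∈ A ∪ B) →
      (∀ e ∈ p.edges, (Sum.inr e : Node V ι) ∈ A ∪ B) → node u ∈ A → node t ∈ A := by
    intro u p
    induction p with
    | nil => exact fun _ _ h => h
    | @cons u v w huv p ih =>
      intro h1 h2 hu
      have he : (Sum.inr s(u, v) : Node V ι) ∈ A := by
        rcases Finset.mem_union.1 (h2 s(u, v) (by simp)) with h | h
        · exact h
        · exact absurd ⟨_, _, hadj u s(u, v) huv (by simp), rfl, rfl⟩ (hsep.no_edge _ hu _ h)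
      have hv : node v ∈ A := by
        rcases Finset.mem_union.1 (h1 v (by simp)) with h | h
        · exact h
        · exact absurd ⟨_, _, (hadj v s(u, v) huv (by simp)).symm, rfl, rfl⟩
            (hsep.no_edge _ he _ h)
      exact ih ht hsep P hcon hnode hedge (fun v hv => h1 v (by simp [hv]))
        (fun e he => h2 e (by simp [he])) hv
  have := key s P.1 hnode hedge (by rw [hR s hs]; exact hsep.left)
  rw [hR t ht] at this
  exact hsep.disj _ this hsep.right

/-- Two edge-disjoint paths can be routed through the incidence graph with the copies `i` and `j`
of the vertices without a common node, except in `U` and at the ends. -/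
def Compatible (R U : Set V) {F : SimpleGraph V} {s t : V} (P Q : F.Path s t) (i j : ι) : Prop :=
  EdgeDisjoint P Q ∧ ∀ v ∈ P.1.support, v ∈ Q.1.support →
    (v ∈ R → v = s ∨ v = t ∨ v ∈ U) ∧ (v ∉ R → i ≠ j)

theorem exists_system [Finite V] [Finite ι] [Inhabited ι] {G F : SimpleGraph V} (hF : F ≤ G)
    {R U : Set V} (hUR : U ⊆ R) {d : V → V → ℕ}
    (hd : U = R ∨ ∀ s ∈ R, ∀ t ∈ R, s ≠ t → d s t ≤ 3)
    (hP : ∀ s ∈ R, ∀ t ∈ R, s ≠ t → ∃ (P : Fin (d s t) → F.Path s t) (σ : Fin (d s t) → ι),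
      Pairwise fun j k => Compatible R U (P j) (P k) (σ j) (σ k)) :
    ∃ T : Node V ι → G.Subgraph, IsSystem R U (Subsingleton ι) d F T := by
  classical
  have := Fintype.ofFinite (Node V ι)
  have hid : IsContraction (incGraph ι R F) (root ι '' R) id :=
    ⟨fun _ _ => rfl, fun _ h => h, fun x y h => by obtain rfl : x = y := h; exact .rfl⟩
  have hfeas : SepFeasible (incGraph ι R F) (root ι '' R) (root ι '' U) (nodeDemand ι d) id := by
    rintro _ ⟨s, hs, rfl⟩ _ ⟨t, ht, rfl⟩ hst A B hsep
    obtain ⟨P, σ, hPσ⟩ := hP s hs t ht fun h => hst (h ▸ rfl)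
    -- Compatible paths hit the separator in different nodes, so it has at least as many elements as
    -- there are paths.
    choose x hx hx' using fun j => exists_mem_separator hs ht hsep (P j) (σ j)
    have hinj : Function.Injective x := by
      intro j k hjk
      by_contra hne
      obtain ⟨h1, h2⟩ := hPσ hne
      rcases hx' j with ⟨e, he, hxe⟩ | ⟨v, hv, hvR, hvn⟩ <;>
        rcases hx' k with ⟨e', he', hxe'⟩ | ⟨v', hv', hvR', hvn'⟩
      · obtain rfl : e = e' := Sum.inr_injective (hxe.symm.trans (hjk.trans hxe'))
        exact h1 e he he'
      · by_cases hR : v' ∈ R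
        · have := (hvR' hR).1; simp [← hjk, hxe, root] at this
        · have := hvn' hR; simp [← hjk, hxe] at this
      · by_cases hR : v ∈ R
        · have := (hvR hR).1; simp [hjk, hxe', root] at this
        · have := hvn hR; simp [hjk, hxe'] at this
      · have hfst : ∀ j v, (v ∈ R → x j = root ι v ∧ v ≠ s ∧ v ≠ t ∧ v ∉ U) →
            (v ∉ R → x j = .inl (v, σ j)) → ∃ i, x j = .inl (v, i) := by
          intro j v h h'
          by_cases hR : v ∈ R
          · exact ⟨_, (h hR).1⟩
          · exact ⟨_, h' hR⟩
        obtain ⟨i, hi⟩ := hfst j v hvR hvn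
        obtain ⟨i', hi'⟩ := hfst k v' hvR' hvn'
        have hvv : (v, i) = (v', i') := Sum.inl_injective (hi.symm.trans (hjk.trans hi'))
        obtain rfl : v = v' := congrArg Prod.fst hvv
        obtain ⟨h3, h4⟩ := h2 v hv hv'
        by_cases hR : v ∈ R
        · obtain ⟨-, hvs, hvt, hvU⟩ := hvR hR
          rcases h3 hR with h | h | h
          · exact hvs h
          · exact hvt h
          · exact hvU h
        · have h5 : (v, σ j) = (v, σ k) :=
            Sum.inl_injective ((hvn hR).symm.trans (hjk.trans (hvn' hR)))
          exact h4 hR (congrArg Prod.snd h5)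
    have := Finset.card_le_card_of_injOn (s := Finset.univ) (t := (A ∪ B)ᶜ) x (fun j _ => hx j)
      hinj.injOn
    rwa [Finset.card_univ, Fintype.card_fin] at this
  have hd' : root ι '' U = root ι '' R ∨ ∀ s ∈ root ι '' R, ∀ t ∈ root ι '' R, s ≠ t →
      nodeDemand ι d s t ≤ 3 := by
    rcases hd with rfl | hd
    · exact Or.inl rfl
    · refine Or.inr ?_
      rintro _ ⟨s, hs, rfl⟩ _ ⟨t, ht, rfl⟩ hst
      exact hd s hs t ht fun h => hst (h ▸ rfl)
  obtain ⟨Γ, hΓ, c, hc, hf, hmono⟩ := exists_contraction (Set.image_mono hUR) hd' _ _ _ hid hfeas rfl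
  refine ⟨piece hF R Γ c, piece_isGood hF hΓ hc hmono, ?_, ?_, ?_, ?_⟩
  · exact fun k k' a b h h' => h.2.1.symm.trans h'.2.1
  · rintro hι k k' v hv (⟨-, i, hi⟩ | h) (⟨-, i', hi'⟩ | h')
    · rw [← hi, ← hi', Subsingleton.elim i i']
    · exact absurd h'.1 hv
    · exact absurd h.1 hv
    · exact absurd h.1 hv
  · exact fun k a b h => h.1
  · exact fun s hs t ht hst => piece_hyperFeasible hF hUR hΓ hc hmono hf hs ht hst

theorem IsSystem.exists_compatible_paths {K : Type*} [Finite V] [Finite K] {G F : SimpleGraph V}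
    {R U : Set V} {D : Prop} {d : V → V → ℕ} {T : K → G.Subgraph} (h : IsSystem R U D d F T)
    {s t : V} (hs : s ∈ R) (ht : t ∈ R) (hst : s ≠ t) :
    ∃ P : Fin (d s t) → F.Path s t,
      (Pairwise fun i j => EdgeDisjoint (P i) (P j) ∧
        ∀ v ∈ (P i).1.support, v ∈ (P j).1.support →
          (v ∈ R → v = s ∨ v = t ∨ v ∈ U) ∧ (v ∉ R → ¬ D)) ∧
      ∀ k, {j | ∃ e ∈ (P j).1.edges, e ∈ (T k).edgeSet}.Subsingleton := by
  obtain ⟨κ, M, P, hκ, hM, hedge, hsupp⟩ := h.exists_paths hs ht hst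
  refine ⟨P, fun i j hij => ⟨fun e he he' => ?_, fun v hv hv' => ⟨fun hR => ?_, fun hR hD => ?_⟩⟩,
    fun k i hi j hj => ?_⟩
  · obtain ⟨k, hk, hke⟩ := hedge i e he
    obtain ⟨k', hk', hke'⟩ := hedge j e he'
    obtain rfl := h.edgeSet_eq hke hke'
    exact hij (hκ i j k hk hk')
  · rcases (hsupp i v hv).1 hR with h1 | h1 | h1
    · exact Or.inl h1
    · exact Or.inr (Or.inl h1)
    · rcases (hsupp j v hv').1 hR with h2 | h2 | h2
      · exact Or.inl h2
      · exact Or.inr (Or.inl h2)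
      · exact Or.inr (Or.inr ((hM i j v h1 h2).resolve_right hij))
  · obtain ⟨k, hk, hkv⟩ := (hsupp i v hv).2
    obtain ⟨k', hk', hkv'⟩ := (hsupp j v hv').2
    obtain rfl := h.steiner hD k k' v hR hkv hkv'
    exact hij (hκ i j k hk hk')
  · obtain ⟨e, he, hek⟩ := hi
    obtain ⟨e', he', hek'⟩ := hj
    obtain ⟨l, hl, hel⟩ := hedge i e he
    obtain ⟨l', hl', hel'⟩ := hedge j e' he'
    obtain rfl := h.edgeSet_eq hel hek
    obtain rfl := h.edgeSet_eq hel' hek'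
    exact hκ i j _ hl hl'

end Paths

/-! ### Minimal solutions -/

section Minimal

variable {V : Type*}

/-- The maximum number of paths that are pairwise related by `Dis` is at least `n` if and only if
there are `n` such paths. -/
theorem le_iSup_paths_iff {F : SimpleGraph V} {s t : V} (Dis : F.Path s t → F.Path s t → Prop)
    (n : ℕ) :
    (n : ℕ∞) ≤ ⨆ (m : ℕ) (_ : ∃ P : Fin m → F.Path s t, Pairwise fun j k => Dis (P j) (P k)),
      (m : ℕ∞) ↔ ∃ P : Fin n → F.Path s t, Pairwise fun j k => Dis (P j) (P k) := by
  constructor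
  · intro h
    by_contra hcon
    have hn : n ≠ 0 := by
      rintro rfl
      exact hcon ⟨Fin.elim0, fun j => j.elim0⟩
    have hle : ⨆ (m : ℕ) (_ : ∃ P : Fin m → F.Path s t, Pairwise fun j k => Dis (P j) (P k)),
        (m : ℕ∞) ≤ ((n - 1 : ℕ) : ℕ∞) := by
      refine iSup₂_le fun m hm => ?_
      rw [Nat.cast_le]
      by_contra hlt
      obtain ⟨P, hP⟩ := hm
      refine hcon ⟨fun j => P (Fin.castLE (by omega) j), fun j k hjk => hP fun h => hjk ?_⟩
      exact Fin.castLE_injective _ h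
    have := h.trans hle
    rw [Nat.cast_le] at this
    omega
  · exact fun h => le_iSup₂ (f := fun (m : ℕ) (_ : ∃ P : Fin m → F.Path s t,
      Pairwise fun j k => Dis (P j) (P k)) => (m : ℕ∞)) n h

/-- The common core of the three variants: `hroute` turns disjoint paths into compatible ones, which
yields a system, and `hdis` turns the paths of a system back into disjoint ones. -/
theorem IsMinimalSolution.exists_trees [Finite V] {I : SNDPInstance V}
    {conn : SimpleGraph V → V → V → ℕ∞}
    {Dis : ∀ {F : SimpleGraph V} {s t : V}, F.Path s t → F.Path s t → Prop}
    (hconn : ∀ (F : SimpleGraph V) (s t : V) (n : ℕ), (n : ℕ∞) ≤ conn F s t ↔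
      ∃ P : Fin n → F.Path s t, Pairwise fun j k => Dis (P j) (P k))
    (ι : Type*) [Finite ι] [Inhabited ι] {U : Set V} (hU : U ⊆ I.terminals)
    (hd : U = I.terminals ∨
      ∀ s ∈ I.terminals, ∀ t ∈ I.terminals, s ≠ t → I.demand s(s, t) ≤ 3)
    (hroute : ∀ (F : SimpleGraph V), ∀ s ∈ I.terminals, ∀ t ∈ I.terminals, s ≠ t →
      ∀ P : Fin (I.demand s(s, t)) → F.Path s t, (Pairwise fun j k => Dis (P j) (P k)) →
      ∃ σ : Fin (I.demand s(s, t)) → ι,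
        Pairwise fun j k => Compatible I.terminals U (P j) (P k) (σ j) (σ k))
    (hdis : ∀ (F : SimpleGraph V) (s t : V), s ≠ t → ∀ P Q : F.Path s t, EdgeDisjoint P Q →
      (∀ v ∈ P.1.support, v ∈ Q.1.support →
        (v ∈ I.terminals → v = s ∨ v = t ∨ v ∈ U) ∧ (v ∉ I.terminals → ¬ Subsingleton ι)) →
      Dis P Q)
    {H : I.graph.Subgraph} (hH : IsMinimalSolution I conn H) :
    ∃ (b : ℕ) (T : Fin b → I.graph.Subgraph),
      IsTreeDecomposition I.terminals H T ∧ Function.Injective T ∧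
      (∀ i j, i ≠ j → Disjoint (T i).edgeSet (T j).edgeSet) ∧
      (Subsingleton ι →
        ∀ i j, i ≠ j → ∀ v, v ∈ (T i).verts → v ∈ (T j).verts → v ∈ I.terminals) ∧
      ∀ s ∈ I.terminals, ∀ t ∈ I.terminals, s ≠ t →
        ∃ P : Fin (I.demand s(s, t)) → H.spanningCoe.Path s t,
          (Pairwise fun j k => Dis (P j) (P k)) ∧ MeetsAtMostOne T P := by
  have hpaths : ∀ (F : SimpleGraph V) (T : Node V ι → I.graph.Subgraph),
      IsSystem I.terminals U (Subsingleton ι) (fun s t => I.demand s(s, t)) F T →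
      ∀ s ∈ I.terminals, ∀ t ∈ I.terminals, s ≠ t →
        ∃ P : Fin (I.demand s(s, t)) → F.Path s t, (Pairwise fun j k => Dis (P j) (P k)) ∧
          ∀ k, {j | ∃ e ∈ (P j).1.edges, e ∈ (T k).edgeSet}.Subsingleton := by
    intro F T hT s hs t ht hst
    obtain ⟨P, hP, hT⟩ := hT.exists_compatible_paths hs ht hst
    exact ⟨P, fun j k hjk => hdis F s t hst _ _ (hP hjk).1 (hP hjk).2, hT⟩
  obtain ⟨T, hT⟩ := exists_system (ι := ι) (d := fun s t => I.demand s(s, t)) H.spanningCoe_le hU hd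
    (by
      intro s hs t ht hst
      obtain ⟨P, hP⟩ := (hconn _ _ _ _).1 (hH.1.2 s hs t ht hst)
      exact ⟨P, hroute _ s hs t ht hst P hP⟩)
  obtain ⟨b, S, h1, h2, h3, h4, h5⟩ := hT.exists_treeDecomposition (by
    -- A system in $H-e$ would provide all demanded paths there, against the minimality of $H$.
    intro e he T' hT'
    refine hH.2 e he ⟨hH.1.1, fun s hs t ht hst => (hconn _ _ _ _).2 ?_⟩
    rw [← SimpleGraph.Subgraph.deleteEdges_spanningCoe_eq]
    obtain ⟨P, hP, -⟩ := hpaths _ T' hT' s hs t ht hst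
    exact ⟨P, hP⟩)
  refine ⟨b, S, h1, h2, h3, h4, fun s hs t ht hst => ?_⟩
  obtain ⟨P, hP, hPT⟩ := hpaths _ T hT s hs t ht hst
  refine ⟨P, hP, fun i => ?_⟩
  rcases h5 i with h | ⟨k, hk⟩
  · simp [h]
  · rw [hk]
    exact hPT k

theorem EdgeDisjoint.ne {F : SimpleGraph V} {s t : V} (hst : s ≠ t) {P Q : F.Path s t}
    (h : EdgeDisjoint P Q) : P ≠ Q := by
  rintro rfl
  obtain ⟨p, hp⟩ := P
  cases p with
  | nil => exact hst rfl
  | cons hadj p => exact h _ List.mem_cons_self List.mem_cons_self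

theorem eq_cons_nil_of_mem_edges {F : SimpleGraph V} {s t : V} {p : F.Walk s t} (hp : p.IsPath)
    (h : s(s, t) ∈ p.edges) : ∃ hadj : F.Adj s t, p = .cons hadj .nil := by
  cases p with
  | nil => simp at h
  | @cons _ v _ hadj p =>
    rw [SimpleGraph.Walk.cons_isPath_iff] at hp
    rw [SimpleGraph.Walk.edges_cons, List.mem_cons] at h
    rcases h with h | h
    · obtain rfl : t = v := Sym2.congr_right.1 h
      exact ⟨hadj, by rw [(SimpleGraph.Walk.isPath_iff_nil.1 hp.1).eq_nil]⟩
    · exact absurd (SimpleGraph.Walk.fst_mem_support_of_mem_edges p h) hp.2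

/-- A common edge has both ends in $\{s,t\}$, so it is $st$ and each path consists of this edge
alone, although the paths are distinct. -/
theorem InternallyDisjoint.edgeDisjoint {F : SimpleGraph V} {s t : V} {P Q : F.Path s t}
    (h : InternallyDisjoint P Q) : EdgeDisjoint P Q := by
  intro e he he'
  have hst : e = s(s, t) := by
    induction e with
    | h a b =>
      have hab : a ≠ b := (P.1.adj_of_mem_edges he).ne
      have ha := h.2 a (P.1.fst_mem_support_of_mem_edges he) (Q.1.fst_mem_support_of_mem_edges he')
      have hb := h.2 b (P.1.snd_mem_support_of_mem_edges he) (Q.1.snd_mem_support_of_mem_edges he')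
      rcases ha with rfl | rfl <;> rcases hb with rfl | rfl
      · exact absurd rfl hab
      · rfl
      · exact Sym2.eq_swap
      · exact absurd rfl hab
  subst hst
  obtain ⟨_, h1⟩ := eq_cons_nil_of_mem_edges P.2 he
  obtain ⟨_, h2⟩ := eq_cons_nil_of_mem_edges Q.2 he'
  exact h.1 (Subtype.ext (h1.trans h2.symm))

end Minimal

end SNDP

theorem mainTheorem8 {V : Type*} [Finite V] (I : SNDPInstance V) :
    -- element-connectivity
    (∀ H : I.graph.Subgraph, SNDP.IsMinimalLCSolution I H →
      ∃ (b : ℕ) (T : Fin b → I.graph.Subgraph),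
        SNDP.IsTreeDecomposition I.terminals H T ∧
        Function.Injective T ∧
        (∀ i j, i ≠ j → ∀ v, v ∈ (T i).verts → v ∈ (T j).verts → v ∈ I.terminals) ∧
        ∀ s ∈ I.terminals, ∀ t ∈ I.terminals, s ≠ t →
          ∃ P : Fin (I.demand s(s, t)) → H.spanningCoe.Path s t,
            (Pairwise fun j k => SNDP.ElementDisjoint I.terminals (P j) (P k)) ∧
            SNDP.MeetsAtMostOne T P) ∧
    -- edge-connectivity
    (∀ H : I.graph.Subgraph, SNDP.IsMinimalECSolution I H →
      ∃ (b : ℕ) (T : Fin b → I.graph.Subgraph),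
        SNDP.IsTreeDecomposition I.terminals H T ∧
        Function.Injective T ∧
        (∀ i j, i ≠ j → Disjoint (T i).edgeSet (T j).edgeSet) ∧
        ∀ s ∈ I.terminals, ∀ t ∈ I.terminals, s ≠ t →
          ∃ P : Fin (I.demand s(s, t)) → H.spanningCoe.Path s t,
            (Pairwise fun j k => SNDP.EdgeDisjoint (P j) (P k)) ∧
            SNDP.MeetsAtMostOne T P) ∧
    -- vertex-connectivity with maximum demand at most three
    ((∀ s ∈ I.terminals, ∀ t ∈ I.terminals, s ≠ t → I.demand s(s, t) ≤ 3) →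
      ∀ H : I.graph.Subgraph, SNDP.IsMinimalVCSolution I H →
      ∃ (b : ℕ) (T : Fin b → I.graph.Subgraph),
        SNDP.IsTreeDecomposition I.terminals H T ∧
        Function.Injective T ∧
        (∀ i j, i ≠ j → ∀ v, v ∈ (T i).verts → v ∈ (T j).verts → v ∈ I.terminals) ∧
        ∀ s ∈ I.terminals, ∀ t ∈ I.terminals, s ≠ t →
          ∃ P : Fin (I.demand s(s, t)) → H.spanningCoe.Path s t,
            (Pairwise fun j k => SNDP.InternallyDisjoint (P j) (P k)) ∧
            SNDP.MeetsAtMostOne T P) := by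
  refine ⟨fun H hH => ?_, fun H hH => ?_, fun hd H hH => ?_⟩
  · obtain ⟨b, T, h1, h2, -, h4, h5⟩ := SNDP.IsMinimalSolution.exists_trees
      (Dis := SNDP.ElementDisjoint I.terminals)
      (fun F s t n => SNDP.le_iSup_paths_iff (SNDP.ElementDisjoint I.terminals) n)
      Unit subset_rfl (Or.inl rfl)
      (fun F s _ t _ _ P hP => ⟨fun _ => (), fun j k hjk => ⟨(hP hjk).1, fun v hv hv' =>
        ⟨fun h => Or.inr (Or.inr h), fun h => absurd ((hP hjk).2 v hv hv') h⟩⟩⟩)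
      (fun F s t _ P Q hPQ h => ⟨hPQ, fun v hv hv' =>
        by_contra fun hR => (h v hv hv').2 hR inferInstance⟩) hH
    exact ⟨b, T, h1, h2, h4 inferInstance, h5⟩
  · have := Fintype.ofFinite (Sym2 V)
    obtain ⟨b, T, h1, h2, h3, -, h5⟩ := SNDP.IsMinimalSolution.exists_trees
      (Dis := SNDP.EdgeDisjoint) (fun F s t n => SNDP.le_iSup_paths_iff SNDP.EdgeDisjoint n)
      -- With at least as many copies as the largest demand, the $j$-th path gets its own copy of
      -- every Steiner vertex. The extra one keeps the type inhabited.
      (Fin (Finset.univ.sup I.demand + 1)) subset_rfl (Or.inl rfl)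
      (fun F s _ t _ _ P hP => ⟨Fin.castLE ((Finset.le_sup (Finset.mem_univ _)).trans
        (Nat.le_succ _)), fun j k hjk => ⟨hP hjk, fun v _ _ =>
          ⟨fun h => Or.inr (Or.inr h), fun _ h => hjk (Fin.castLE_injective _ h)⟩⟩⟩)
      (fun F s t _ P Q hPQ _ => hPQ) hH
    exact ⟨b, T, h1, h2, h3, h5⟩
  · obtain ⟨b, T, h1, h2, -, h4, h5⟩ := SNDP.IsMinimalSolution.exists_trees
      (Dis := SNDP.InternallyDisjoint)
      (fun F s t n => SNDP.le_iSup_paths_iff SNDP.InternallyDisjoint n)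
      -- With $U$ empty, terminals other than $s$ and $t$ count in separators, and the bound $3$
      -- takes the place of the condition that all terminals lie in $U$.
      Unit (U := ∅) (Set.empty_subset _) (Or.inr hd)
      (fun F s hs t ht _ P hP => ⟨fun _ => (), fun j k hjk =>
        ⟨(hP hjk).edgeDisjoint, fun v hv hv' => by
          rcases (hP hjk).2 v hv hv' with rfl | rfl
          · exact ⟨fun _ => Or.inl rfl, fun h => absurd hs h⟩
          · exact ⟨fun _ => Or.inr (Or.inl rfl), fun h => absurd ht h⟩⟩⟩)
      (fun F s t hst P Q hPQ h => ⟨hPQ.ne hst, fun v hv hv' => by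
        by_cases hR : v ∈ I.terminals
        · simpa using (h v hv hv').1 hR
        · exact ((h v hv hv').2 hR inferInstance).elim⟩) hH
    exact ⟨b, T, h1, h2, h4 inferInstance, h5⟩
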